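/- Let $\mathbb D$ be the open unit disk and $\mathbb T$ the unit circle. Let $\varphi$ be a nonconstant meromorphic function on $\mathbb C$ with no pole on $\overline{\mathbb D}$. Then the minima and the maximum below exist, the set $G(\varphi)$ is finite, and the following four integers coincide: $$n(\varphi)=b(\varphi)=o(\varphi)=N(\varphi),$$ where - $n(\varphi)=\min\{\operatorname{wind}(\varphi,\varphi(a)) : a\in\mathbb D,\ \varphi(a)\notin\varphi(\mathbb T)\}$, with $\operatorname{wind}(\varphi,c)$ the winding number of the closed curve $z\mapsto\varphi(z)$ $(z\in\mathbb T)$ around $c\notin\varphi(\mathbb T)$; - $b(\varphi)$ is the Cowen–Thomson order, i.e. the maximum of the orders of the finite Blaschke products $B$ for which there is a bounded holomorphic function $\psi$ on $\mathbb D$ with $\varphi=\psi\circ B$ on $\mathbb D$; - $o(\varphi)$ is the number of elements of the set $G(\varphi)$ of all continuous maps $\rho:\mathbb T\to\mathbb T$ with $\varphi\circ\rho=\varphi$ on $\mathbb T$; - $N(\varphi)=\min\{\#\{w\in\mathbb T:\varphi(w)=\varphi(\eta)\} : \eta\in\mathbb T\}$. In particular $b(\varphi)=n(\varphi)$: every such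 $\varphi$ has the Minimal Winding Number property, so the question of Baker–Deddens–Ullman and Thomson has an affirmative answer for this class. -/

import Mathlib

namespace SymbolCurve

/-- `MeroClosedDisk φ`: `φ` is meromorphic on `ℂ` and has no pole on the closed unit disk.
A Lean function `ℂ → ℂ` carries values everywhere, so "no pole" is the requirement that `φ` is
holomorphic on a neighbourhood of every point of the closed disk; the values of `φ` at its poles,
which lie outside the closed disk, play no role. -/
structure MeroClosedDisk (φ : ℂ → ℂ) : Prop where
  meromorphic : Meromorphic φ
  holomorphic : AnalyticOnNhd ℂ φ (Metric.closedBall 0 1)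

/-- `ψ` is a bounded holomorphic function on the open unit disk. -/
def IsHInfty (ψ : ℂ → ℂ) : Prop :=
  DifferentiableOn ℂ ψ (Metric.ball 0 1) ∧ ∃ C : ℝ, ∀ z ∈ Metric.ball (0 : ℂ) 1, ‖ψ z‖ ≤ C

/-- `B` is a finite Blaschke product of order `m`. -/
def IsBlaschkeOfOrder (B : ℂ → ℂ) (m : ℕ) : Prop :=
  ∃ (c : ℂ) (a : Fin m → ℂ), ‖c‖ = 1 ∧ (∀ i, ‖a i‖ < 1) ∧
    ∀ z : ℂ, B z = c * ∏ i, (z - a i) / (1 - (starRingEnd ℂ) (a i) * z)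

/-- The orders of the finite Blaschke products `B` such that `φ = ψ ∘ B` on the open unit disk for
some `ψ` in `H^∞`. The Cowen–Thomson order `b(φ)` is the maximum of this set. -/
def blaschkeOrders (φ : ℂ → ℂ) : Set ℕ :=
  {m | ∃ B ψ : ℂ → ℂ, IsBlaschkeOfOrder B m ∧ IsHInfty ψ ∧
    ∀ z ∈ Metric.ball (0 : ℂ) 1, φ z = ψ (B z)}

/-- The closed curve `γ`, parametrized by the unit circle, omits the point `c` and has winding
number `k` around it: along the path `t ↦ γ (e^{it}) - c` there is a continuous logarithm `L`, whose
total increment over `[0, 2π]` is `2πik`. -/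
def HasWindingNumber (γ : Circle → ℂ) (c : ℂ) (k : ℤ) : Prop :=
  ∃ L : ℝ → ℂ, Continuous L ∧ (∀ t : ℝ, γ (Circle.exp t) - c = Complex.exp (L t)) ∧
    L (2 * Real.pi) - L 0 = 2 * Real.pi * Complex.I * k

/-- The winding numbers of the curve `φ(𝕋)` around the points `φ(a)` with `a` in the open unit disk
and `φ(a)` not on the curve. The number `n(φ)` is the minimum of this set. -/
def windingNumbers (φ : ℂ → ℂ) : Set ℤ :=
  {k | ∃ a : ℂ, ‖a‖ < 1 ∧ (∀ w : Circle, φ w ≠ φ a) ∧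
    HasWindingNumber (fun w : Circle => φ w) (φ a) k}

/-- `G(φ)`: the continuous maps `ρ` from the unit circle to itself with `φ ∘ ρ = φ`. The number
`o(φ)` is its cardinality. -/
def symmetries (φ : ℂ → ℂ) : Set C(Circle, Circle) :=
  {ρ | ∀ w : Circle, φ (ρ w) = φ w}

/-- `N(φ - φ(η), 𝕋)`: the number of points `w` of the unit circle with `φ(w) = φ(η)`
(possibly infinite). -/
noncomputable def selfIntersection (φ : ℂ → ℂ) (η : Circle) : ℕ∞ :=
  {w : Circle | φ w = φ η}.encard

end SymbolCurve

namespace SymbolCurve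

/-! ### Countable exceptional sets in the plane: connectedness, isolated points, removability. -/

section

open Filter Topology Set Metric

/-! Identify `w` with `z` when `φ w = φ z` and also `φ (refl w) = φ (refl z)`, where `refl` is the
reflection in the circle. On the circle the second equation repeats the first, so this relation
continues the self-intersections of the curve to the plane. Its classes (`fiber`) are finite,
because `w` or `refl w` lies in the closed disk. Off a countable set they are the values of a fixed
number `d` of analytic branches (`countable_not_good`, `exists_ncard_fiber`). The product of a
function over the fibers is single valued, and when it is bounded it extends holomorphically across
the countable set.

Global meromorphy is what makes the relation preserve the open disk (`norm_lt_one_of_mem_fiber`). If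
`φ` has a pole `p`, take the Blaschke factor vanishing at `refl p`. It is bounded on the fibers of
points near the closed disk, since `φ` is bounded there and so those fibers stay away from `p`. If
`φ` is entire, a Liouville argument bounds the fibers, and the identity function does the same job.
The product over the fibers is then unimodular on the circle and vanishes somewhere inside, so its
modulus is less than one in the disk. As it is constant on fibers and compatible with reflection, no
fiber can leave the disk.

Now symmetrize the Blaschke factor of a generic point of the disk. The result is a finite Blaschke
product `B` of order `m ≤ d`, constant on fibers. Its levels have at most `m` points, so over
generic points of the disk they are exactly the fibers. Hence `φ = ψ ∘ B`, and at all but countably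
many points of the circle `φ` and `B` have the same level (`IsSymbol.exists_blaschke`).

All four numbers equal `m`. On the circle `B` takes each unimodular value `m` times and its argument
increases, so it has `m` symmetries. A factorization through a Blaschke product of order `k` gives
`φ - φ(a)` at least `k` zeros, which bounds winding numbers below. For the opposite bound, let `a`
approach a preimage of a boundary point of the image of the closed disk, chosen off a countable set
of bad values. All preimages of that point are noncritical, lie on the circle and share one level of
`B`, so `φ - φ(a)` has at most `m` zeros, all simple (`exists_factorization_le`). -/

theorem isPreconnected_compl_of_countable {A : Set ℂ} (hA : A.Countable) : IsPreconnected Aᶜ :=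
  (hA.isConnected_compl_of_one_lt_rank (by simp)).isPreconnected

theorem dense_compl_of_countable {A : Set ℂ} (hA : A.Countable) : Dense Aᶜ :=
  hA.dense_compl ℂ

/-- The exterior of a disk stays connected when a countable set is removed. -/
theorem isPreconnected_exterior_diff {A : Set ℂ} (hA : A.Countable) {R : ℝ} (hR : 0 ≤ R) :
    IsPreconnected ({w : ℂ | R < ‖w‖} \ A) := by
  -- Pushing radially outwards by `R` maps the punctured plane bijectively onto the exterior, which
  -- reduces the claim to the complement of a countable set.
  set e : ℂ → ℂ := fun w => (1 + R / ‖w‖ : ℝ) • w with he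
  have hnorm : ∀ w : ℂ, w ≠ 0 → ‖e w‖ = ‖w‖ + R := by
    intro w hw
    have : 0 < ‖w‖ := norm_pos_iff.2 hw
    rw [he]; simp only [norm_smul, Real.norm_eq_abs]
    rw [abs_of_pos (by positivity)]; field_simp
  have hinj : InjOn e {0}ᶜ := by
    intro w hw v hv h
    have hw' : w ≠ 0 := hw
    have hv' : v ≠ 0 := hv
    have h1 : ‖w‖ = ‖v‖ := by
      have := congrArg norm h
      rw [hnorm w hw', hnorm v hv'] at this; linarith
    have h2 : (1 + R / ‖w‖ : ℝ) • w = (1 + R / ‖w‖ : ℝ) • v := by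
      have := h; simp only [he] at this; rw [this, h1]
    have : (1 + R / ‖w‖ : ℝ) ≠ 0 := by positivity
    exact smul_right_injective ℂ this h2
  have hcount : ({0}ᶜ ∩ e ⁻¹' A : Set ℂ).Countable := by
    refine Set.MapsTo.countable_of_injOn (f := e) (t := A) (fun x hx => hx.2) ?_ hA
    exact hinj.mono inter_subset_left
  have himg : {w : ℂ | R < ‖w‖} \ A = e '' ({0} ∪ ({0}ᶜ ∩ e ⁻¹' A))ᶜ := by
    ext w
    constructor
    · rintro ⟨hw, hwA⟩
      have hw : R < ‖w‖ := hw
      have hpos : 0 < ‖w‖ := hR.trans_lt hw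
      have hk : 0 < 1 - R / ‖w‖ := by rw [sub_pos, div_lt_one hpos]; exact hw
      have hw0 : w ≠ 0 := norm_pos_iff.1 hpos
      have hx0 : (1 - R / ‖w‖ : ℝ) • w ≠ 0 := smul_ne_zero hk.ne' hw0
      have hex : e ((1 - R / ‖w‖ : ℝ) • w) = w := by
        have hn : ‖(1 - R / ‖w‖ : ℝ) • w‖ = ‖w‖ - R := by
          rw [norm_smul, Real.norm_eq_abs, abs_of_pos hk]; field_simp
        simp only [he]; rw [hn, smul_smul]
        have : (1 + R / (‖w‖ - R)) * (1 - R / ‖w‖) = 1 := by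
          have : ‖w‖ - R ≠ 0 := by linarith
          field_simp; ring
        rw [this, one_smul]
      refine ⟨_, ?_, hex⟩
      simp only [mem_compl_iff, mem_union, mem_singleton_iff, hx0, mem_inter_iff, mem_preimage,
        hex, hwA, and_false, or_self, not_false_eq_true]
    · rintro ⟨x, hx, rfl⟩
      simp only [mem_compl_iff, mem_union, mem_singleton_iff, mem_inter_iff, mem_preimage,
        not_or, not_and] at hx
      refine ⟨?_, hx.2 hx.1⟩
      show R < ‖e x‖
      rw [hnorm x hx.1]
      have : 0 < ‖x‖ := norm_pos_iff.2 hx.1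
      linarith
  rw [himg]
  refine (isPreconnected_compl_of_countable ((countable_singleton 0).union hcount)).image e ?_
  intro x hx
  have hx0 : x ≠ 0 := fun h => hx (Or.inl h)
  have : ‖x‖ ≠ 0 := norm_ne_zero_iff.2 hx0
  apply ContinuousAt.continuousWithinAt
  simp only [he]
  fun_prop (disch := assumption)

/-- The zeros of a nonzero analytic function on a connected open set are countable. -/
theorem countable_zeros {f : ℂ → ℂ} {U : Set ℂ} (hf : AnalyticOnNhd ℂ f U) (hU : IsPreconnected U)
    {x : ℂ} (hx : x ∈ U) (hfx : f x ≠ 0) : {z ∈ U | f z = 0}.Countable := by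
  have h := hf.preimage_zero_mem_codiscreteWithin hfx hx ⟨⟨x, hx⟩, hU⟩
  rw [preimage_compl] at h
  have := (HereditarilyLindelofSpace.isLindelof _).countable_of_isDiscrete
    (isDiscrete_of_codiscreteWithin h)
  refine this.mono ?_
  rintro z ⟨hz, h0⟩
  exact ⟨h0, hz⟩

/-- A nonempty countable locally closed subset of the plane has an isolated point. -/
theorem exists_isolated_of_countable {S : Set ℂ} (hS : S.Countable) (hl : IsLocallyClosed S)
    (hne : S.Nonempty) : ∃ a ∈ S, ∃ ε > 0, ∀ z ∈ ball a ε, z ∈ S → z = a := by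
  have : LocallyCompactSpace S := hl.locallyCompactSpace
  have : Countable S := hS.to_subtype
  have : Nonempty S := hne.to_subtype
  -- Baire: a locally compact space that is a countable union of closed singletons has an open one.
  obtain ⟨i, hi⟩ := nonempty_interior_of_iUnion_of_closed (X := S) (f := fun x : S => {x})
    (fun x => isClosed_singleton) (by ext x; simp)
  obtain ⟨x, hx⟩ := hi
  have hxi : x = i := by simpa using interior_subset hx
  subst hxi
  rw [mem_interior_iff_mem_nhds, Metric.mem_nhds_iff] at hx
  obtain ⟨ε, hε, hb⟩ := hx
  refine ⟨x, x.2, ε, hε, fun z hz hzS => ?_⟩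
  have := hb (show (⟨z, hzS⟩ : S) ∈ ball x ε from hz)
  simpa using congrArg Subtype.val (mem_singleton_iff.1 this)

/-- Riemann's removable singularity theorem for a countable relatively closed set. -/
theorem exists_extension_of_countable {U A : Set ℂ} {h : ℂ → ℂ} (hU : IsOpen U) (hA : A.Countable)
    (hUA : IsOpen (U \ A)) (hd : DifferentiableOn ℂ h (U \ A)) {C : ℝ}
    (hb : ∀ z ∈ U \ A, ‖h z‖ ≤ C) : ∃ F : ℂ → ℂ, DifferentiableOn ℂ F U ∧ EqOn F h (U \ A) := by
  have hfreq : ∀ z : ℂ, ∃ᶠ w in 𝓝 z, w ∉ A := by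
    intro z
    have := (dense_compl_of_countable hA) z
    exact mem_closure_iff_frequently.1 this
  -- `P z F` says that `F` is a local holomorphic extension of `h` at `z`. Such germs have a unique
  -- value at `z` because the complement of `A` is dense, so they glue over `S`.
  set P : ℂ → (ℂ → ℂ) → Prop := fun z F => AnalyticAt ℂ F z ∧ ∀ᶠ w in 𝓝 z, w ∉ A → F w = h w with hP
  set S : Set ℂ := {z ∈ U | ∃ F, P z F} with hSdef
  have hev : ∀ z F, P z F → ∀ᶠ w in 𝓝 z, P w F := by
    rintro z F ⟨h1, h2⟩
    filter_upwards [h1.eventually_analyticAt, h2.eventually_nhds] with w ha hb using ⟨ha, hb⟩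
  have huniq : ∀ z F G, P z F → P z G → F z = G z := by
    rintro z F G ⟨hF, hF'⟩ ⟨hG, hG'⟩
    by_contra hne
    have h1 : ∀ᶠ w in 𝓝 z, F w - G w ≠ 0 :=
      (hF.continuousAt.sub hG.continuousAt).eventually_ne (sub_ne_zero.2 hne)
    obtain ⟨w, hwA, h2, h3, h4⟩ := ((hfreq z).and_eventually (h1.and (hF'.and hG'))).exists
    exact h2 (sub_eq_zero.2 ((h3 hwA).trans (h4 hwA).symm))
  have hopen : IsOpen S := by
    rw [isOpen_iff_mem_nhds]
    rintro z ⟨hz, F, hF⟩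
    filter_upwards [hU.mem_nhds hz, hev z F hF] with w hw hw' using ⟨hw, F, hw'⟩
  have hsub : U \ A ⊆ S := by
    intro z hz
    refine ⟨hz.1, h, ?_, Eventually.of_forall fun w _ => rfl⟩
    exact (hd.analyticOnNhd hUA) z hz
  choose! F hF using fun z (hz : z ∈ S) => hz.2
  set G : ℂ → ℂ := fun z => F z z with hG
  have hGF : ∀ z ∈ S, G =ᶠ[𝓝 z] F z := by
    intro z hz
    filter_upwards [hopen.mem_nhds hz, hev z (F z) (hF z hz)] with w hw hw'
    exact huniq w (F w) (F z) (hF w hw) hw'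
  have hGan : ∀ z ∈ S, AnalyticAt ℂ G z := fun z hz => (hF z hz).1.congr (hGF z hz).symm
  have hGh : EqOn G h (U \ A) := fun z hz => (hF z (hsub hz)).2.self_of_nhds hz.2
  have hGb : ∀ z ∈ S, ‖G z‖ ≤ C := by
    intro z hz
    by_contra! hlt
    have h1 : ∀ᶠ w in 𝓝 z, C < ‖G w‖ := (hGan z hz).continuousAt.norm.eventually_const_lt hlt
    obtain ⟨w, hwA, h2, h3⟩ := ((hfreq z).and_eventually (h1.and (hU.mem_nhds hz.1))).exists
    rw [hGh ⟨h3, hwA⟩] at h2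
    exact absurd (hb w ⟨h3, hwA⟩) (not_le.2 h2)
  -- The set of points without a local extension is countable and locally closed. If it were
  -- nonempty it would have an isolated point, where the classical removable singularity theorem
  -- applies.
  have hall : U \ S = ∅ := by
    by_contra hne
    have hne := nonempty_iff_ne_empty.2 hne
    have hcount : (U \ S).Countable := hA.mono fun z hz => by
      by_contra hzA
      exact hz.2 (hsub ⟨hz.1, hzA⟩)
    obtain ⟨a, ha, ε, hε, hiso⟩ := exists_isolated_of_countable hcount
      (hU.isLocallyClosed.inter hopen.isClosed_compl.isLocallyClosed) hne
    obtain ⟨δ, hδ, hδU⟩ := Metric.isOpen_iff.1 hU a ha.1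
    set s := ball a (min ε δ) with hs
    have hs1 : ∀ z ∈ s \ {a}, z ∈ S := by
      rintro z ⟨hz, hza⟩
      by_contra hzS
      exact hza (hiso z (ball_subset_ball (min_le_left _ _) hz)
        ⟨hδU (ball_subset_ball (min_le_right _ _) hz), hzS⟩)
    have hsn : s ∈ 𝓝 a := ball_mem_nhds a (lt_min hε hδ)
    have hD := Complex.differentiableOn_update_limUnder_of_bddAbove (f := G) hsn
      (fun z hz => (hGan z (hs1 z hz)).differentiableAt.differentiableWithinAt)
      ⟨C, by rintro _ ⟨z, hz, rfl⟩; exact hGb z (hs1 z hz)⟩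
    refine ha.2 ⟨ha.1, _, hD.analyticAt hsn, ?_⟩
    filter_upwards [hsn] with w hw hwA
    have hwa : w ≠ a := by
      rintro rfl
      exact ha.2 (hsub ⟨ha.1, hwA⟩)
    rw [Function.update_of_ne hwa]
    exact hGh ⟨(hs1 w ⟨hw, hwa⟩).1, hwA⟩
  have hUS : U ⊆ S := sdiff_eq_empty.1 hall
  exact ⟨G, fun z hz => (hGan z (hUS hz)).differentiableAt.differentiableWithinAt, hGh⟩

end

/-! ### Zeros, Blaschke form and winding numbers for functions analytic on the closed disk. -/

section

open Filter Topology Set Metric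

/-- The zeros of an analytic function in the closed unit disk that does not vanish on the circle
can be divided out. -/
theorem exists_factorization {f : ℂ → ℂ} (hf : AnalyticOnNhd ℂ f (closedBall 0 1))
    (hT : ∀ z : ℂ, ‖z‖ = 1 → f z ≠ 0) :
    ∃ (n : ℕ) (a : Fin n → ℂ) (g : ℂ → ℂ), (∀ i, ‖a i‖ < 1) ∧
      AnalyticOnNhd ℂ g (closedBall 0 1) ∧ (∀ z ∈ closedBall (0 : ℂ) 1, g z ≠ 0) ∧
      ∀ z ∈ closedBall (0 : ℂ) 1, f z = (∏ i, (z - a i)) * g z := by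
  have hconn : IsPreconnected (closedBall (0 : ℂ) 1) := (convex_closedBall 0 1).isPreconnected
  have hfin : ∀ f : ℂ → ℂ, AnalyticOnNhd ℂ f (closedBall 0 1) → (∀ z : ℂ, ‖z‖ = 1 → f z ≠ 0) →
      ({z ∈ closedBall (0 : ℂ) 1 | f z = 0} : Set ℂ).Finite := by
    intro f hf hT
    by_contra hinf
    have hinf : ({z ∈ closedBall (0 : ℂ) 1 | f z = 0} : Set ℂ).Infinite := hinf
    obtain ⟨z, hz, hacc⟩ := hinf.exists_accPt_of_subset_isCompact (isCompact_closedBall 0 1)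
      (fun z hz => hz.1)
    have h := hf.eqOn_zero_of_preconnected_of_frequently_eq_zero hconn hz
      ((accPt_iff_frequently_nhdsNE.1 hacc).mono fun w hw => hw.2)
    exact hT 1 (by simp) (h (by simp))
  -- Induction on the number of distinct zeros; each zero is divided out with its full multiplicity
  -- `p`.
  obtain ⟨k, hk⟩ : ∃ k, ({z ∈ closedBall (0 : ℂ) 1 | f z = 0} : Set ℂ).ncard = k := ⟨_, rfl⟩
  induction k generalizing f with
  | zero =>
    rw [Set.ncard_eq_zero (hfin f hf hT)] at hk
    refine ⟨0, Fin.elim0, f, fun i => i.elim0, hf, fun z hz h0 => ?_, by simp⟩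
    have : z ∈ ({z ∈ closedBall (0 : ℂ) 1 | f z = 0} : Set ℂ) := ⟨hz, h0⟩
    rw [hk] at this
    exact this
  | succ k ih =>
    obtain ⟨a, ha, ha0⟩ : ({z ∈ closedBall (0 : ℂ) 1 | f z = 0} : Set ℂ).Nonempty := by
      rw [← Set.ncard_pos (hfin f hf hT), hk]; omega
    have ha1 : ‖a‖ < 1 :=
      lt_of_le_of_ne (by simpa using ha) fun h => hT a h ha0
    have hne : ¬ ∀ᶠ z in 𝓝 a, f z = 0 := fun h =>
      hT 1 (by simp) (hf.eqOn_zero_of_preconnected_of_eventuallyEq_zero hconn ha h (by simp))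
    obtain ⟨p, g₀, hg₀, hg₀a, heq⟩ := (hf a ha).exists_eventuallyEq_pow_smul_nonzero_iff.2 hne
    set g : ℂ → ℂ := fun z => if z = a then g₀ a else f z / (z - a) ^ p with hgdef
    have hgnear : g =ᶠ[𝓝 a] g₀ := by
      filter_upwards [heq] with z hz
      by_cases h : z = a
      · simp [hgdef, h]
      · simp only [hgdef, h, if_false, hz, smul_eq_mul]
        have : z - a ≠ 0 := sub_ne_zero.2 h
        field_simp
    have hfar : ∀ b, b ≠ a → g =ᶠ[𝓝 b] fun z => f z / (z - a) ^ p := by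
      intro b hb
      filter_upwards [eventually_ne_nhds hb] with z hz
      simp [hgdef, hz]
    have hgan : AnalyticOnNhd ℂ g (closedBall 0 1) := by
      intro b hb
      by_cases h : b = a
      · subst h; exact hg₀.congr hgnear.symm
      · refine AnalyticAt.congr ?_ (hfar b h).symm
        refine (hf b hb).fun_div (by fun_prop) (pow_ne_zero _ (sub_ne_zero.2 h))
    have hfg : ∀ z ∈ closedBall (0 : ℂ) 1, f z = (z - a) ^ p * g z := by
      intro z hz
      by_cases h : z = a
      · subst h
        rw [heq.self_of_nhds]; simp [hgdef]
      · have : z - a ≠ 0 := sub_ne_zero.2 h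
        simp only [hgdef, h, if_false]; field_simp
    have hgT : ∀ z : ℂ, ‖z‖ = 1 → g z ≠ 0 := by
      intro z hz h0
      exact hT z hz (by rw [hfg z (by simp [hz]), h0, mul_zero])
    have hga : g a ≠ 0 := by simpa [hgdef] using hg₀a
    have hset : ({z ∈ closedBall (0 : ℂ) 1 | g z = 0} : Set ℂ) =
        {z ∈ closedBall (0 : ℂ) 1 | f z = 0} \ {a} := by
      ext z
      constructor
      · rintro ⟨hz, h0⟩
        refine ⟨⟨hz, by rw [hfg z hz, h0, mul_zero]⟩, fun h => hga ?_⟩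
        rw [mem_singleton_iff] at h; rw [← h]; exact h0
      · rintro ⟨⟨hz, h0⟩, hza⟩
        refine ⟨hz, ?_⟩
        rw [hfg z hz, mul_eq_zero] at h0
        exact h0.resolve_left (pow_ne_zero _ (sub_ne_zero.2 hza))
    obtain ⟨n, b, G, hb, hGan, hGne, hG⟩ := ih hgan hgT (by
      rw [hset, Set.ncard_sdiff_singleton_of_mem
        (show a ∈ ({z ∈ closedBall (0 : ℂ) 1 | f z = 0} : Set ℂ) from ⟨ha, ha0⟩), hk]; omega)
    refine ⟨p + n, Fin.append (fun _ => a) b, G, ?_, hGan, hGne, fun z hz => ?_⟩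
    · intro i
      refine Fin.addCases (fun i => ?_) (fun i => ?_) i
      · simpa using ha1
      · simpa using hb i
    · rw [hfg z hz, hG z hz, Fin.prod_univ_add]
      simp [mul_assoc]

theorem norm_one_sub_conj_mul {a z : ℂ} (hz : ‖z‖ = 1) :
    ‖1 - (starRingEnd ℂ) a * z‖ = ‖z - a‖ := by
  have h1 : z * (starRingEnd ℂ) z = 1 := by
    rw [Complex.mul_conj, Complex.normSq_eq_norm_sq, hz]; simp
  have : 1 - (starRingEnd ℂ) a * z = z * (starRingEnd ℂ) (z - a) := by
    rw [map_sub, mul_sub, h1]; ring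
  rw [this, norm_mul, hz, one_mul, Complex.norm_conj]

theorem one_sub_conj_mul_ne_zero {a z : ℂ} (ha : ‖a‖ < 1) (hz : ‖z‖ ≤ 1) :
    1 - (starRingEnd ℂ) a * z ≠ 0 := by
  intro h
  have h1 : (starRingEnd ℂ) a * z = 1 := (sub_eq_zero.1 h).symm
  have := congrArg norm h1
  rw [norm_mul, Complex.norm_conj, norm_one] at this
  nlinarith [norm_nonneg a, norm_nonneg z]

/-- A function analytic on the closed disk, zero free, of constant modulus one on the circle is
constant. -/
theorem eq_const_of_norm_eq_one {q : ℂ → ℂ} (hq : AnalyticOnNhd ℂ q (closedBall 0 1))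
    (h0 : ∀ z ∈ closedBall (0 : ℂ) 1, q z ≠ 0) (hT : ∀ z : ℂ, ‖z‖ = 1 → ‖q z‖ = 1) :
    ∃ c : ℂ, ‖c‖ = 1 ∧ ∀ z ∈ closedBall (0 : ℂ) 1, q z = c := by
  have hmax : ∀ f : ℂ → ℂ, AnalyticOnNhd ℂ f (closedBall 0 1) → (∀ z : ℂ, ‖z‖ = 1 → ‖f z‖ = 1) →
      ∀ z ∈ closedBall (0 : ℂ) 1, ‖f z‖ ≤ 1 := by
    intro f hf h1 z hz
    refine Complex.norm_le_of_forall_mem_frontier_norm_le (U := ball (0 : ℂ) 1) isBounded_ball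
      ?_ (fun w hw => ?_) (by rwa [closure_ball _ one_ne_zero])
    · refine DifferentiableOn.diffContOnCl ?_
      rw [closure_ball _ one_ne_zero]
      exact hf.differentiableOn
    · rw [frontier_ball _ one_ne_zero] at hw
      exact (h1 w (by simpa using hw)).le
  have h1 : ∀ z ∈ closedBall (0 : ℂ) 1, ‖q z‖ = 1 := by
    intro z hz
    refine le_antisymm (hmax q hq hT z hz) ?_
    -- The maximum principle for `1/q` gives the lower bound.
    have := hmax (fun w => (q w)⁻¹) (fun w hw => (hq w hw).fun_inv (h0 w hw))
      (fun w hw => by rw [norm_inv, hT w hw, inv_one]) z hz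
    rw [norm_inv] at this
    exact (inv_le_one₀ (norm_pos_iff.2 (h0 z hz))).1 this
  have hb : EqOn q (Function.const ℂ (q 0)) (ball 0 1) := by
    refine Complex.eqOn_of_isPreconnected_of_isMaxOn_norm (convex_ball 0 1).isPreconnected
      isOpen_ball (hq.differentiableOn.mono ball_subset_closedBall) (by simp) ?_
    intro z hz
    show ‖q z‖ ≤ ‖q 0‖
    rw [h1 z (ball_subset_closedBall hz), h1 0 (by simp)]
  refine ⟨q 0, h1 0 (by simp), fun z hz => ?_⟩
  have hcl : EqOn q (Function.const ℂ (q 0)) (closure (ball 0 1)) := by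
    refine hb.of_subset_closure ?_ continuousOn_const subset_closure subset_rfl
    rw [closure_ball _ one_ne_zero]; exact hq.continuousOn
  exact hcl (by rwa [closure_ball _ one_ne_zero])

/-- A function analytic on the closed disk and unimodular on the circle is a finite Blaschke
product there. -/
theorem exists_blaschke {f : ℂ → ℂ} (hf : AnalyticOnNhd ℂ f (closedBall 0 1))
    (hT : ∀ z : ℂ, ‖z‖ = 1 → ‖f z‖ = 1) :
    ∃ (m : ℕ) (c : ℂ) (a : Fin m → ℂ), ‖c‖ = 1 ∧ (∀ i, ‖a i‖ < 1) ∧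
      ∀ z ∈ closedBall (0 : ℂ) 1,
        f z = c * ∏ i, (z - a i) / (1 - (starRingEnd ℂ) (a i) * z) := by
  obtain ⟨m, a, g, ha, hg, hg0, hfg⟩ := exists_factorization hf
    (fun z hz h => by have := hT z hz; rw [h] at this; simp at this)
  have hden : ∀ z ∈ closedBall (0 : ℂ) 1, ∏ i, (1 - (starRingEnd ℂ) (a i) * z) ≠ 0 :=
    fun z hz => Finset.prod_ne_zero_iff.2 fun i _ =>
      one_sub_conj_mul_ne_zero (ha i) (by simpa using hz)
  -- The function `q` is the quotient of `f` by the Blaschke product with the same zeros.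
  obtain ⟨c, hc, hq⟩ := eq_const_of_norm_eq_one
    (q := fun z => (∏ i, (1 - (starRingEnd ℂ) (a i) * z)) * g z)
    (fun z hz => by
      refine AnalyticAt.mul ?_ (hg z hz)
      exact Finset.analyticAt_fun_prod _ fun i _ => by fun_prop)
    (fun z hz => mul_ne_zero (hden z hz) (hg0 z hz))
    (fun z hz => by
      have hz' : z ∈ closedBall (0 : ℂ) 1 := by simp [hz]
      rw [norm_mul, norm_prod, Finset.prod_congr rfl fun i _ => norm_one_sub_conj_mul hz,
        ← norm_prod, ← norm_mul, ← hfg z hz', hT z hz])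
  refine ⟨m, c, a, hc, ha, fun z hz => ?_⟩
  rw [hfg z hz, Finset.prod_div_distrib, ← hq z hz]
  rw [mul_div_assoc', eq_div_iff (hden z hz)]
  ring

/-- The winding number of a curve around a point is unique. -/
theorem HasWindingNumber.unique {γ : Circle → ℂ} {c : ℂ} {k l : ℤ} (hk : HasWindingNumber γ c k)
    (hl : HasWindingNumber γ c l) : k = l := by
  obtain ⟨L, hL, hLe, hLi⟩ := hk
  obtain ⟨M, hM, hMe, hMi⟩ := hl
  have h2 : ∀ t, ∃ n : ℤ, L t - M t = n * (2 * Real.pi * Complex.I) := by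
    intro t
    have : Complex.exp (L t) = Complex.exp (M t) := (hLe t).symm.trans (hMe t)
    obtain ⟨n, hn⟩ := Complex.exp_eq_exp_iff_exists_int.1 this
    exact ⟨n, by rw [hn]; ring⟩
  choose n hn using h2
  have hpi : (2 * Real.pi * Complex.I : ℂ) ≠ 0 := Complex.two_pi_I_ne_zero
  -- Two continuous logarithms differ by `2πi` times a continuous integer valued function, hence by
  -- a constant.
  have hcont : Continuous fun t => ((n t : ℤ) : ℂ) := by
    have : (fun t => ((n t : ℤ) : ℂ)) = fun t => (L t - M t) / (2 * Real.pi * Complex.I) := by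
      ext t; rw [hn t]; field_simp
    rw [this]; fun_prop
  have hcn : Continuous n := by
    have hcr : Continuous fun t => ((n t : ℤ) : ℝ) := by
      have := Complex.continuous_re.comp hcont
      simpa [Function.comp_def] using this
    exact Int.isClosedEmbedding_coe_real.isEmbedding.continuous_iff.2 hcr
  have hnn : n (2 * Real.pi) = n 0 := PreconnectedSpace.constant inferInstance hcn
  have h3 := hn (2 * Real.pi)
  have h4 := hn 0
  rw [hnn, ← h4] at h3
  have h5 : (2 * Real.pi * Complex.I : ℂ) * k = 2 * Real.pi * Complex.I * l := by
    rw [← hLi, ← hMi]; linear_combination h3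
  exact_mod_cast mul_left_cancel₀ hpi h5

/-- A zero free analytic function on the closed disk has a logarithm along the circle with period
`2π`. -/
theorem exists_log_circle {g : ℂ → ℂ} (hg : AnalyticOnNhd ℂ g (closedBall 0 1))
    (hg0 : ∀ z ∈ closedBall (0 : ℂ) 1, g z ≠ 0) :
    ∃ L : ℝ → ℂ, Continuous L ∧ (∀ t : ℝ, g (Circle.exp t) = Complex.exp (L t)) ∧
      L (2 * Real.pi) - L 0 = 0 := by
  have hopen : IsOpen {z | AnalyticAt ℂ g z ∧ g z ≠ 0} := by
    rw [isOpen_iff_mem_nhds]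
    rintro z ⟨h1, h2⟩
    filter_upwards [h1.eventually_analyticAt, h1.continuousAt.eventually_ne h2] with w a b
      using ⟨a, b⟩
  obtain ⟨δ, hδ, hsub⟩ := (isCompact_closedBall (0 : ℂ) 1).exists_thickening_subset_open hopen
    (fun z hz => ⟨hg z hz, hg0 z hz⟩)
  rw [thickening_closedBall hδ zero_le_one] at hsub
  -- A primitive `H` of the logarithmic derivative on a larger disk is a logarithm of `g`; read
  -- along the circle it is automatically periodic.
  have hd : DifferentiableOn ℂ (fun z => deriv g z / g z) (ball 0 (1 + δ)) := by
    intro z hz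
    have h := hsub (by rwa [add_comm] at hz)
    exact ((h.1.deriv.differentiableAt).fun_div h.1.differentiableAt h.2).differentiableWithinAt
  have h0 : (0 : ℂ) ∈ ball (0 : ℂ) (1 + δ) := by simp; linarith
  obtain ⟨H, hH0, hH⟩ := hd.isExactOn_ball.with_val_at 0 (Complex.log (g 0))
  have hmem : ∀ t : ℝ, (Circle.exp t : ℂ) ∈ ball (0 : ℂ) (1 + δ) := by
    intro t; simp; linarith
  have key : ∀ z ∈ ball (0 : ℂ) (1 + δ), g z * Complex.exp (-H z) = g 0 * Complex.exp (-H 0) := by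
    intro z hz
    refine (convex_ball (0 : ℂ) (1 + δ)).is_const_of_fderivWithin_eq_zero (𝕜 := ℂ)
      (f := fun z => g z * Complex.exp (-H z)) ?_ ?_ hz h0
    · intro w hw
      have h := hsub (by rwa [add_comm] at hw)
      exact (h.1.differentiableAt.fun_mul
        (hH w hw).differentiableAt.fun_neg.cexp).differentiableWithinAt
    · intro w hw
      have h := hsub (by rwa [add_comm] at hw)
      have hdw : HasDerivAt (fun z => g z * Complex.exp (-H z)) 0 w := by
        refine (h.1.differentiableAt.hasDerivAt.fun_mul ((hH w hw).fun_neg.cexp)).congr_deriv ?_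
        have hgw : g w ≠ 0 := h.2
        field_simp
        ring
      rw [fderivWithin_of_isOpen isOpen_ball hw]
      ext
      simpa using hdw.deriv
  refine ⟨fun t => H (Circle.exp t), ?_, fun t => ?_, ?_⟩
  · have hc : ContinuousOn H (ball 0 (1 + δ)) := fun z hz => (hH z hz).continuousAt.continuousWithinAt
    exact hc.comp_continuous (by fun_prop) hmem
  · have h := key _ (hmem t)
    rw [hH0] at h
    have hg00 : g 0 ≠ 0 := hg0 0 (by simp)
    rw [Complex.exp_neg, Complex.exp_neg, Complex.exp_log hg00, mul_inv_cancel₀ hg00] at h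
    exact (mul_inv_eq_one₀ (Complex.exp_ne_zero _)).1 h
  · simp

/-- The argument principle on the closed disk, in factored form. -/
theorem hasWindingNumber_of_factorization {f : ℂ → ℂ} {c : ℂ} {n : ℕ} {a : Fin n → ℂ} {g : ℂ → ℂ}
    (ha : ∀ i, ‖a i‖ < 1) (hg : AnalyticOnNhd ℂ g (closedBall 0 1))
    (hg0 : ∀ z ∈ closedBall (0 : ℂ) 1, g z ≠ 0)
    (hf : ∀ z ∈ closedBall (0 : ℂ) 1, f z - c = (∏ i, (z - a i)) * g z) :
    HasWindingNumber (fun w : Circle => f w) c n := by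
  obtain ⟨L, hL, hLe, hLi⟩ := exists_log_circle hg hg0
  -- On the circle `z - a = e^{it} (1 - a e^{-it})`. The second factor stays in the right
  -- half-plane, so its principal logarithm is continuous and periodic, and each zero contributes
  -- exactly `2πi`.
  have hslit : ∀ i (t : ℝ), 1 - a i * Complex.exp (-(t * Complex.I)) ∈ Complex.slitPlane := by
    intro i t
    refine Complex.mem_slitPlane_iff.2 (Or.inl ?_)
    have h1 : (a i * Complex.exp (-(t * Complex.I))).re ≤ ‖a i‖ := by
      refine (Complex.re_le_norm _).trans ?_
      rw [norm_mul, ← neg_mul, ← Complex.ofReal_neg, Complex.norm_exp_ofReal_mul_I, mul_one]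
    simp only [Complex.sub_re, Complex.one_re]
    linarith [ha i]
  refine ⟨fun t => (∑ i, (t * Complex.I + Complex.log (1 - a i * Complex.exp (-(t * Complex.I)))))
    + L t, ?_, fun t => ?_, ?_⟩
  · refine Continuous.add ?_ hL
    refine continuous_finsetSum _ fun i _ => ?_
    refine Continuous.add (by fun_prop) ?_
    exact Continuous.clog (by fun_prop) (hslit i)
  · have hz : (Circle.exp t : ℂ) ∈ closedBall (0 : ℂ) 1 := by simp
    rw [hf _ hz, hLe t, Complex.exp_add, Complex.exp_sum]
    congr 1
    refine Finset.prod_congr rfl fun i _ => ?_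
    rw [Complex.exp_add, Complex.exp_log (Complex.slitPlane_ne_zero (hslit i t)), Circle.coe_exp,
      mul_sub, mul_one, mul_left_comm, ← Complex.exp_add]
    simp
  · have hper : Complex.exp (-(((2 * Real.pi : ℝ) : ℂ) * Complex.I)) = 1 := by
      rw [Complex.exp_neg]; push_cast; rw [Complex.exp_two_pi_mul_I, inv_one]
    rw [add_sub_add_comm, hLi, ← Finset.sum_sub_distrib, hper]
    simp
    ring

end

/-! ### The identification relation, its analytic branches and its generic points. -/

section

open Filter Topology Set Metric

/-- Reflection in the unit circle. -/
noncomputable def refl (z : ℂ) : ℂ := ((starRingEnd ℂ) z)⁻¹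

@[simp] theorem refl_refl (z : ℂ) : refl (refl z) = z := by simp [refl]

@[simp] theorem norm_refl (z : ℂ) : ‖refl z‖ = ‖z‖⁻¹ := by simp [refl]

@[simp] theorem refl_eq_zero {z : ℂ} : refl z = 0 ↔ z = 0 := by simp [refl]

theorem refl_injective : Function.Injective refl :=
  (show Function.Involutive refl from refl_refl).injective

theorem refl_eq_self {z : ℂ} (hz : ‖z‖ = 1) : refl z = z := by
  have h : z * (starRingEnd ℂ) z = 1 := by
    rw [Complex.mul_conj, Complex.normSq_eq_norm_sq, hz]; simp
  exact (eq_inv_of_mul_eq_one_left h).symm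

theorem continuousAt_refl {z : ℂ} (hz : z ≠ 0) : ContinuousAt refl z :=
  ContinuousAt.inv₀ Complex.continuous_conj.continuousAt (by simpa using hz)

theorem countable_refl_preimage {A : Set ℂ} (hA : A.Countable) : (refl ⁻¹' A).Countable :=
  hA.preimage_of_injOn refl_injective.injOn

/-- Conjugating before and after preserves holomorphy, and what remains is inversion. This turns the
second defining equation of `fiber` into one between analytic functions. -/
theorem analyticAt_conj_comp_refl {φ : ℂ → ℂ} {z : ℂ} (hz : z ≠ 0) (h : AnalyticAt ℂ φ (refl z)) :
    AnalyticAt ℂ (fun w => (starRingEnd ℂ) (φ (refl w))) z := by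
  rw [Complex.analyticAt_iff_eventually_differentiableAt] at h ⊢
  filter_upwards [(continuousAt_refl hz).eventually h, eventually_ne_nhds hz] with w hw hw0
  have h1 : DifferentiableAt ℂ ((starRingEnd ℂ) ∘ φ ∘ (starRingEnd ℂ)) w⁻¹ := by
    have := hw.conj_conj
    rwa [refl, map_inv₀, Complex.conj_conj] at this
  have h2 := h1.comp w (differentiableAt_inv hw0)
  refine h2.congr_of_eventuallyEq (Eventually.of_forall fun v => ?_)
  simp [refl, map_inv₀]

/-- A symbol normalised so that every point is a point of analyticity or a genuine pole. -/
structure IsSymbol (φ : ℂ → ℂ) : Prop where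
  holomorphic : AnalyticOnNhd ℂ φ (closedBall 0 1)
  pole : ∀ z, AnalyticAt ℂ φ z ∨ Tendsto φ (𝓝[≠] z) (Bornology.cobounded ℂ)
  countable : {z | AnalyticAt ℂ φ z}ᶜ.Countable
  nonconst : ¬ ∃ c : ℂ, ∀ z ∈ closedBall (0 : ℂ) 1, φ z = c

variable {φ : ℂ → ℂ}

theorem IsSymbol.isPreconnected (hφ : IsSymbol φ) : IsPreconnected {z | AnalyticAt ℂ φ z} := by
  simpa using isPreconnected_compl_of_countable hφ.countable

theorem IsSymbol.countable_level (hφ : IsSymbol φ) (c : ℂ) :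
    {z | AnalyticAt ℂ φ z ∧ φ z = c}.Countable := by
  obtain ⟨x, hx, hxc⟩ : ∃ x ∈ closedBall (0 : ℂ) 1, φ x ≠ c := by
    by_contra! h; exact hφ.nonconst ⟨c, h⟩
  refine (countable_zeros (f := fun z => φ z - c) (U := {z | AnalyticAt ℂ φ z})
    (fun z hz => AnalyticAt.fun_sub hz analyticAt_const) hφ.isPreconnected
    (x := x) (hφ.holomorphic x hx) (sub_ne_zero.2 hxc)).mono ?_
  rintro z ⟨h1, h2⟩
  exact ⟨h1, sub_eq_zero.2 h2⟩

theorem IsSymbol.exists_deriv_ne_zero (hφ : IsSymbol φ) :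
    ∃ x ∈ closedBall (0 : ℂ) 1, deriv φ x ≠ 0 := by
  by_contra! h
  refine hφ.nonconst ⟨φ 0, fun z hz => ?_⟩
  have := (convex_closedBall (0 : ℂ) 1).norm_image_sub_le_of_norm_deriv_le (𝕜 := ℂ) (f := φ)
    (C := 0) (x := 0) (y := z) (fun x hx => (hφ.holomorphic x hx).differentiableAt)
    (fun x hx => by simp [h x hx]) (by simp) hz
  simpa [sub_eq_zero] using this

theorem IsSymbol.countable_critical (hφ : IsSymbol φ) : {z | deriv φ z = 0}.Countable := by
  obtain ⟨x, hx, hxc⟩ := hφ.exists_deriv_ne_zero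
  refine ((countable_zeros (f := deriv φ) (U := {z | AnalyticAt ℂ φ z})
    (fun z hz => AnalyticAt.deriv hz) hφ.isPreconnected
    (x := x) (hφ.holomorphic x hx) hxc).union hφ.countable).mono ?_
  intro z hz
  by_cases h : AnalyticAt ℂ φ z
  · exact Or.inl ⟨h, hz⟩
  · exact Or.inr h

theorem IsSymbol.finite_level (hφ : IsSymbol φ) (c : ℂ) :
    {z ∈ closedBall (0 : ℂ) 1 | φ z = c}.Finite := by
  by_contra hinf
  have hinf : ({z ∈ closedBall (0 : ℂ) 1 | φ z = c} : Set ℂ).Infinite := hinf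
  obtain ⟨z, hz, hacc⟩ := hinf.exists_accPt_of_subset_isCompact (isCompact_closedBall 0 1)
    (fun z hz => hz.1)
  have h := hφ.holomorphic.eqOn_of_preconnected_of_frequently_eq (g := fun _ => c)
    (fun _ _ => analyticAt_const) (convex_closedBall 0 1).isPreconnected hz
    ((accPt_iff_frequently_nhdsNE.1 hacc).mono fun w hw => hw.2)
  exact hφ.nonconst ⟨c, h⟩

/-- The points at which both `φ` and its reflection are regular. -/
def Reg (φ : ℂ → ℂ) (z : ℂ) : Prop := z ≠ 0 ∧ AnalyticAt ℂ φ z ∧ AnalyticAt ℂ φ (refl z)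

theorem Reg.refl {z : ℂ} (h : Reg φ z) : Reg φ (refl z) :=
  ⟨by simpa using h.1, h.2.2, by simpa using h.2.1⟩

theorem eventually_reg {z : ℂ} (h : Reg φ z) : ∀ᶠ w in 𝓝 z, Reg φ w := by
  filter_upwards [eventually_ne_nhds h.1, h.2.1.eventually_analyticAt,
    (continuousAt_refl h.1).eventually h.2.2.eventually_analyticAt] with w a b c using ⟨a, b, c⟩

theorem IsSymbol.countable_not_reg (hφ : IsSymbol φ) : {z | ¬ Reg φ z}.Countable := by
  refine (((countable_singleton 0).union hφ.countable).union
    (countable_refl_preimage hφ.countable)).mono fun z hz => ?_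
  by_contra h
  simp only [mem_union, mem_singleton_iff, mem_compl_iff, mem_preimage, not_or, not_not] at h
  exact hz ⟨h.1.1, h.1.2, h.2⟩

theorem IsSymbol.reg_of_norm_eq_one (hφ : IsSymbol φ) {z : ℂ} (hz : ‖z‖ = 1) : Reg φ z := by
  have h := hφ.holomorphic z (by simp [hz])
  exact ⟨fun h0 => by simp [h0] at hz, h, by rwa [refl_eq_self hz]⟩

/-- The points identified with `z` by both `φ` and its reflection. -/
def fiber (φ : ℂ → ℂ) (z : ℂ) : Set ℂ :=
  {w | Reg φ z ∧ Reg φ w ∧ φ w = φ z ∧ φ (refl w) = φ (refl z)}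

theorem mem_fiber_self {z : ℂ} (h : Reg φ z) : z ∈ fiber φ z := ⟨h, h, rfl, rfl⟩

theorem mem_fiber_symm {z w : ℂ} (h : w ∈ fiber φ z) : z ∈ fiber φ w :=
  ⟨h.2.1, h.1, h.2.2.1.symm, h.2.2.2.symm⟩

theorem fiber_eq_of_mem {z w : ℂ} (h : w ∈ fiber φ z) : fiber φ w = fiber φ z := by
  ext v
  constructor
  · intro hv; exact ⟨h.1, hv.2.1, hv.2.2.1.trans h.2.2.1, hv.2.2.2.trans h.2.2.2⟩
  · intro hv; exact ⟨h.2.1, hv.2.1, hv.2.2.1.trans h.2.2.1.symm, hv.2.2.2.trans h.2.2.2.symm⟩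

theorem refl_mem_fiber {z w : ℂ} (h : w ∈ fiber φ z) : refl w ∈ fiber φ (refl z) :=
  ⟨h.1.refl, h.2.1.refl, h.2.2.2, by simpa using h.2.2.1⟩

theorem fiber_refl (z : ℂ) : fiber φ (refl z) = refl '' fiber φ z := by
  ext w
  constructor
  · intro h; exact ⟨refl w, by simpa using refl_mem_fiber h, by simp⟩
  · rintro ⟨v, hv, rfl⟩; exact refl_mem_fiber hv

/-- Either `w` or its reflection lies in the closed disk, where levels of `φ` are finite. -/
theorem IsSymbol.finite_fiber (hφ : IsSymbol φ) (z : ℂ) : (fiber φ z).Finite := by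
  refine ((hφ.finite_level (φ z)).union
    ((hφ.finite_level (φ (SymbolCurve.refl z))).preimage refl_injective.injOn)).subset ?_
  rintro w ⟨-, hw, h1, h2⟩
  rcases le_total ‖w‖ 1 with h | h
  · exact Or.inl ⟨by simpa using h, h1⟩
  · exact Or.inr ⟨by simpa using inv_le_one_of_one_le₀ h, h2⟩

/-- Near `z₀` the fiber is the set of values of finitely many analytic branches. -/
def Good (φ : ℂ → ℂ) (z₀ : ℂ) : Prop :=
  ∃ (d : ℕ) (ρ : Fin d → ℂ → ℂ), (∀ i, AnalyticAt ℂ (ρ i) z₀) ∧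
    Function.Injective (fun i => ρ i z₀) ∧ ∀ᶠ z in 𝓝 z₀, fiber φ z = range fun i => ρ i z

theorem eventually_injective {d : ℕ} {ρ : Fin d → ℂ → ℂ} {z₀ : ℂ}
    (hρ : ∀ i, ContinuousAt (ρ i) z₀) (hinj : Function.Injective fun i => ρ i z₀) :
    ∀ᶠ z in 𝓝 z₀, Function.Injective fun i => ρ i z := by
  have : ∀ᶠ z in 𝓝 z₀, ∀ i j, i ≠ j → ρ i z - ρ j z ≠ 0 := by
    simp only [eventually_all]
    intro i j hij
    exact ((hρ i).sub (hρ j)).eventually_ne (sub_ne_zero.2 fun h => hij (hinj h))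
  filter_upwards [this] with z hz i j hij
  by_contra hne
  exact hz i j hne (sub_eq_zero.2 hij)

theorem eventually_good {z : ℂ} (h : Good φ z) : ∀ᶠ w in 𝓝 z, Good φ w := by
  obtain ⟨d, ρ, h1, h2, h3⟩ := h
  have h1' : ∀ᶠ w in 𝓝 z, ∀ i, AnalyticAt ℂ (ρ i) w :=
    eventually_all.2 fun i => (h1 i).eventually_analyticAt
  filter_upwards [h1', eventually_injective (fun i => (h1 i).continuousAt) h2,
    h3.eventually_nhds] with w a b c using ⟨d, ρ, a, b, c⟩

/-- The local branch of `φ⁻¹ ∘ φ` with a prescribed noncritical value. -/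
theorem exists_branch {z₀ w₀ : ℂ} (hz : AnalyticAt ℂ φ z₀) (hw : AnalyticAt ℂ φ w₀)
    (hd : deriv φ w₀ ≠ 0) (h : φ w₀ = φ z₀) :
    ∃ ρ : ℂ → ℂ, AnalyticAt ℂ ρ z₀ ∧ ρ z₀ = w₀ ∧ (∀ᶠ z in 𝓝 z₀, φ (ρ z) = φ z) ∧
      ∀ᶠ p : ℂ × ℂ in 𝓝 (z₀, w₀), φ p.2 = φ p.1 → p.2 = ρ p.1 := by
  set g := hw.hasStrictDerivAt.localInverse φ (deriv φ w₀) w₀ hd with hg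
  have hga : AnalyticAt ℂ g (φ w₀) := hw.analyticAt_localInverse hd
  have hleft : ∀ᶠ x in 𝓝 w₀, g (φ x) = x :=
    HasStrictFDerivAt.eventually_left_inverse _
  have hright : ∀ᶠ x in 𝓝 (φ w₀), φ (g x) = x :=
    HasStrictFDerivAt.eventually_right_inverse _
  have hgz : AnalyticAt ℂ g (φ z₀) := h ▸ hga
  refine ⟨g ∘ φ, hgz.comp hz, ?_, ?_, ?_⟩
  · simp only [Function.comp_apply, ← h]; exact hleft.self_of_nhds
  · rw [h] at hright
    exact hz.continuousAt.eventually hright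
  · have := (continuous_snd.tendsto (z₀, w₀)).eventually hleft
    filter_upwards [this] with p hp hpp
    simp only [Function.comp_apply, ← hpp, hp]

/-- Near a point that is not identified with `z₀`, no point is identified with a point close to
`z₀`. -/
theorem IsSymbol.eventually_ne (hφ : IsSymbol φ) {z₀ x : ℂ} (hz : AnalyticAt ℂ φ z₀)
    (h : AnalyticAt ℂ φ x → φ x ≠ φ z₀) :
    ∀ᶠ p : ℂ × ℂ in 𝓝 (z₀, x), AnalyticAt ℂ φ p.2 → φ p.2 ≠ φ p.1 := by
  have hfst : ContinuousAt (fun p : ℂ × ℂ => φ p.1) (z₀, x) :=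
    ContinuousAt.comp (f := Prod.fst) (x := (z₀, x)) hz.continuousAt continuous_fst.continuousAt
  by_cases hx : AnalyticAt ℂ φ x
  · have hsnd : ContinuousAt (fun p : ℂ × ℂ => φ p.2) (z₀, x) :=
      ContinuousAt.comp (f := Prod.snd) (x := (z₀, x)) hx.continuousAt continuous_snd.continuousAt
    filter_upwards [(hsnd.sub hfst).eventually_ne (sub_ne_zero.2 (h hx))] with p hp _ hpp
    exact hp (sub_eq_zero.2 hpp)
  -- At a pole `φ` blows up, while it stays bounded near `z₀`; the pole itself is excluded by
  -- analyticity.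
  · have hp := (hφ.pole x).resolve_left hx
    have h1 : ∀ᶠ v in 𝓝[≠] x, ‖φ z₀‖ + 1 < ‖φ v‖ :=
      (tendsto_norm_atTop_iff_cobounded.2 hp).eventually_gt_atTop _
    rw [eventually_nhdsWithin_iff] at h1
    have h2 : ∀ᶠ p : ℂ × ℂ in 𝓝 (z₀, x), ‖φ p.1‖ < ‖φ z₀‖ + 1 :=
      hfst.norm.eventually_lt_const (by simp)
    filter_upwards [h2, (continuous_snd.tendsto (z₀, x)).eventually h1] with p hp1 hp2 han heq
    have : p.2 ≠ x := by rintro rfl; exact hx han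
    have := hp2 this
    rw [heq] at this
    linarith

/-- Through each point of the fiber passes a local branch of `φ⁻¹ ∘ φ`. By `hacc` the reflected
equation holds along it at points accumulating at `z₀`, hence identically. Compactness then shows
that nearby fibers contain nothing else; the conditions involving `φ 0` keep them away from infinity
and from zero. -/
theorem IsSymbol.good_of (hφ : IsSymbol φ) {z₀ : ℂ} (hz : Reg φ z₀) (h0 : φ z₀ ≠ φ 0)
    (h0' : φ (refl z₀) ≠ φ 0) (hd : ∀ w ∈ fiber φ z₀, deriv φ w ≠ 0)
    (hacc : ∀ w ∈ fiber φ z₀, ∃ᶠ p : ℂ × ℂ in 𝓝[≠] (z₀, w), p.2 ∈ fiber φ p.1) : Good φ z₀ := by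
  have hfin := hφ.finite_fiber z₀
  have han0 : AnalyticAt ℂ φ 0 := hφ.holomorphic 0 (by simp)
  have hbr : ∀ w ∈ fiber φ z₀, ∃ ρ : ℂ → ℂ, AnalyticAt ℂ ρ z₀ ∧ ρ z₀ = w ∧
      (∀ᶠ z in 𝓝 z₀, ρ z ∈ fiber φ z) ∧
      ∀ᶠ p : ℂ × ℂ in 𝓝 (z₀, w), φ p.2 = φ p.1 → p.2 = ρ p.1 := by
    intro w hw
    obtain ⟨ρ, hρ, hρw, hρφ, huniq⟩ := exists_branch hz.2.1 hw.2.1.2.1 (hd w hw) hw.2.2.1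
    refine ⟨ρ, hρ, hρw, ?_, huniq⟩
    have hA : AnalyticAt ℂ (fun z => (starRingEnd ℂ) (φ (SymbolCurve.refl z))) z₀ :=
      analyticAt_conj_comp_refl hz.1 hz.2.2
    have hB : AnalyticAt ℂ (fun z => (starRingEnd ℂ) (φ (SymbolCurve.refl (ρ z)))) z₀ := by
      have : AnalyticAt ℂ (fun z => (starRingEnd ℂ) (φ (SymbolCurve.refl z))) (ρ z₀) := by
        rw [hρw]; exact analyticAt_conj_comp_refl hw.2.1.1 hw.2.1.2.2
      exact this.comp hρ
    -- A nearby pair of identified points lies on the branch, so if it differs from `(z₀, w)` its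
    -- first coordinate already differs from `z₀`.
    have hfr : ∃ᶠ p : ℂ × ℂ in 𝓝 (z₀, w), p.1 ≠ z₀ ∧
        (starRingEnd ℂ) (φ (SymbolCurve.refl (ρ p.1))) =
          (starRingEnd ℂ) (φ (SymbolCurve.refl p.1)) := by
      have h1 := frequently_nhdsWithin_iff.1 (hacc w hw)
      refine (h1.and_eventually huniq).mono ?_
      rintro p ⟨⟨hp1, hp2⟩, hp3⟩
      have hp := hp3 hp1.2.2.1
      refine ⟨fun h => hp2 ?_, ?_⟩
      · rw [mem_singleton_iff]
        ext1
        · exact h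
        · rw [hp, h, hρw]
      · rw [← hp, hp1.2.2.2]
    have hfr' := (continuous_fst.tendsto (z₀, w)).frequently (p := fun z => z ≠ z₀ ∧
      (starRingEnd ℂ) (φ (SymbolCurve.refl (ρ z))) = (starRingEnd ℂ) (φ (SymbolCurve.refl z))) hfr
    have hev := (hB.frequently_eq_iff_eventually_eq hA).1
      (frequently_nhdsWithin_iff.2 (hfr'.mono fun z hz => ⟨hz.2, hz.1⟩))
    have hregρ : ∀ᶠ z in 𝓝 z₀, Reg φ (ρ z) := by
      refine hρ.continuousAt.eventually ?_
      rw [hρw]; exact eventually_reg hw.2.1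
    filter_upwards [hev, hregρ, hρφ, eventually_reg hz] with z e1 e2 e3 e4
    exact ⟨e4, e2, e3, (starRingEnd ℂ).injective e1⟩
  choose! ρ hρan hρval hρmem hρuniq using hbr
  have e := hfin.to_subtype
  obtain ⟨d, ⟨e⟩⟩ := Finite.exists_equiv_fin (fiber φ z₀)
  refine ⟨d, fun i => ρ (e.symm i), fun i => hρan _ (e.symm i).2, ?_, ?_⟩
  · intro i j hij
    simp only [hρval _ (e.symm _).2] at hij
    exact e.symm.injective (Subtype.ext hij)
  have hsub : ∀ᶠ z in 𝓝 z₀, ∀ i, ρ (e.symm i) z ∈ fiber φ z :=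
    eventually_all.2 fun i => hρmem _ (e.symm i).2
  have hrefl : Tendsto SymbolCurve.refl (𝓝 z₀) (𝓝 (SymbolCurve.refl z₀)) := continuousAt_refl hz.1
  -- A large `w` has its reflection near `0`, where `φ` is close to `φ 0` and so differs from `φ
  -- (refl z₀)`.
  obtain ⟨ε, hε, hfar⟩ : ∃ ε > 0, ∀ᶠ z in 𝓝 z₀, ∀ w ∈ fiber φ z, w ∈ closedBall (0 : ℂ) ε := by
    have h := hφ.eventually_ne (x := 0) hz.2.2 (fun _ => h0'.symm)
    rw [nhds_prod_eq, eventually_prod_iff] at h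
    obtain ⟨P, hP, Q, hQ, hPQ⟩ := h
    obtain ⟨δ, hδ, hball⟩ := Metric.eventually_nhds_iff_ball.1 hQ
    refine ⟨δ⁻¹, inv_pos.2 hδ, ?_⟩
    filter_upwards [hrefl.eventually hP] with z hPz w hw
    by_contra hout
    have hout : δ⁻¹ < ‖w‖ := by simpa using hout
    refine hPQ hPz (hball (SymbolCurve.refl w) ?_) hw.2.1.2.2 hw.2.2.2
    simpa using inv_lt_of_inv_lt₀ hδ hout
  have hnear : ∀ᶠ z in 𝓝 z₀, ∀ w ∈ closedBall (0 : ℂ) ε,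
      w ∈ fiber φ z → w ∈ range fun i => ρ (e.symm i) z := by
    refine (isCompact_closedBall (0 : ℂ) ε).eventually_forall_of_forall_eventually ?_
    intro w _
    by_cases hw1 : AnalyticAt ℂ φ w ∧ φ w = φ z₀
    swap
    · filter_upwards [hφ.eventually_ne hz.2.1 (fun h h' => hw1 ⟨h, h'⟩)] with p hp hpf
      exact absurd hpf.2.2.1 (hp hpf.2.1.2.1)
    -- Needed because `refl` is not continuous at `0`.
    have hw0 : w ≠ 0 := by
      rintro rfl
      exact h0 hw1.2.symm
    by_cases hw2 : AnalyticAt ℂ φ (SymbolCurve.refl w) ∧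
        φ (SymbolCurve.refl w) = φ (SymbolCurve.refl z₀)
    swap
    · have h := hφ.eventually_ne hz.2.2 (fun h h' => hw2 ⟨h, h'⟩)
      have ht : Tendsto (fun p : ℂ × ℂ => (SymbolCurve.refl p.1, SymbolCurve.refl p.2))
          (𝓝 (z₀, w)) (𝓝 (SymbolCurve.refl z₀, SymbolCurve.refl w)) := by
        refine Tendsto.prodMk_nhds ?_ ?_
        · exact hrefl.comp (continuous_fst.tendsto (z₀, w))
        · exact (continuousAt_refl hw0).tendsto.comp (continuous_snd.tendsto (z₀, w))
      filter_upwards [ht.eventually h] with p hp hpf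
      exact absurd hpf.2.2.2 (hp hpf.2.1.2.2)
    have hwf : w ∈ fiber φ z₀ := ⟨hz, ⟨hw0, hw1.1, hw2.1⟩, hw1.2, hw2.2⟩
    filter_upwards [hρuniq w hwf] with p hp hpf
    exact ⟨e ⟨w, hwf⟩, by simp [hp hpf.2.2.1]⟩
  filter_upwards [hsub, hfar, hnear] with z e1 e2 e3
  refine Subset.antisymm (fun w hw => e3 w (e2 w hw) hw) ?_
  rintro _ ⟨i, rfl⟩
  exact e1 i

/-- The accumulation hypothesis of `good_of` fails only at isolated points of the relation in `ℂ ×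
ℂ`, which form a discrete and therefore countable set. Each of the other hypotheses fails on a
countable set too: by symmetry, fibers meeting a critical point `w` are over the finite fiber of
`w`. -/
theorem IsSymbol.countable_not_good (hφ : IsSymbol φ) : {z | ¬ Good φ z}.Countable := by
  set E : Set (ℂ × ℂ) := {p | p.2 ∈ fiber φ p.1} with hE
  set I : Set (ℂ × ℂ) := {p ∈ E | ¬ ∃ᶠ q in 𝓝[≠] p, q ∈ E} with hI
  have hIc : I.Countable := by
    have : DiscreteTopology I := by
      rw [discreteTopology_subtype_iff]
      rintro p ⟨hp, hfr⟩
      rw [← disjoint_iff, disjoint_principal_right]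
      rw [not_frequently] at hfr
      filter_upwards [hfr] with q hq hqI using hq hqI.1
    exact (HereditarilyLindelofSpace.isLindelof I).countable this
  have hcrit := hφ.countable_critical
  have h0 := hφ.countable_level (φ 0)
  refine ((((hφ.countable_not_reg.union h0).union (countable_refl_preimage h0)).union
    (hcrit.biUnion fun w _ => (hφ.finite_fiber w).countable)).union
    (hIc.image Prod.fst)).mono fun z hz => ?_
  by_contra h
  simp only [mem_union, not_or, mem_iUnion, not_exists, mem_image, mem_preimage] at h
  obtain ⟨⟨⟨⟨h1, h2⟩, h3⟩, h4⟩, h5⟩ := h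
  have hreg : Reg φ z := by simpa using h1
  refine hz (hφ.good_of hreg (fun h => h2 ⟨hreg.2.1, h⟩) (fun h => h3 ⟨hreg.2.2, h⟩) ?_ ?_)
  · intro w hw hd
    exact h4 w hd (mem_fiber_symm hw)
  · intro w hw
    by_contra hfr
    exact h5 (z, w) ⟨⟨hw, hfr⟩, rfl⟩

/-- The generic points: every point identified with `z`, and its reflection, is good and
noncritical. -/
def generic (φ : ℂ → ℂ) : Set ℂ :=
  {z | Reg φ z ∧ ∀ w ∈ fiber φ z, (Good φ w ∧ deriv φ w ≠ 0) ∧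
    (Good φ (refl w) ∧ deriv φ (refl w) ≠ 0)}

theorem generic_of_mem_fiber {z w : ℂ} (hz : z ∈ generic φ) (hw : w ∈ fiber φ z) :
    w ∈ generic φ :=
  ⟨hw.2.1, by rw [fiber_eq_of_mem hw]; exact hz.2⟩

theorem refl_mem_generic {z : ℂ} (hz : z ∈ generic φ) : refl z ∈ generic φ := by
  refine ⟨hz.1.refl, ?_⟩
  rw [fiber_refl]
  rintro _ ⟨w, hw, rfl⟩
  rw [refl_refl]
  exact (hz.2 w hw).symm

theorem good_of_generic {z : ℂ} (hz : z ∈ generic φ) : Good φ z :=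
  (hz.2 z (mem_fiber_self hz.1)).1.1

theorem deriv_ne_zero_of_generic {z : ℂ} (hz : z ∈ generic φ) : deriv φ z ≠ 0 :=
  (hz.2 z (mem_fiber_self hz.1)).1.2

theorem isOpen_generic : IsOpen (generic φ) := by
  rw [isOpen_iff_mem_nhds]
  intro z hz
  obtain ⟨d, ρ, h1, h2, h3⟩ := good_of_generic hz
  have hnoncrit : ∀ w, AnalyticAt ℂ φ w → Good φ w ∧ deriv φ w ≠ 0 →
      ∀ᶠ v in 𝓝 w, Good φ v ∧ deriv φ v ≠ 0 := fun w ha hw =>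
    (eventually_good hw.1).and (ha.deriv.continuousAt.eventually_ne hw.2)
  have h4 : ∀ᶠ x in 𝓝 z, ∀ i, (Good φ (ρ i x) ∧ deriv φ (ρ i x) ≠ 0) ∧
      (Good φ (refl (ρ i x)) ∧ deriv φ (refl (ρ i x)) ≠ 0) := by
    refine eventually_all.2 fun i => ?_
    refine (h1 i).continuousAt.eventually (p := fun v => (Good φ v ∧ deriv φ v ≠ 0) ∧
      (Good φ (refl v) ∧ deriv φ (refl v) ≠ 0)) ?_
    have hmem : ρ i z ∈ fiber φ z := by rw [h3.self_of_nhds]; exact ⟨i, rfl⟩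
    have hg := hz.2 _ hmem
    exact (hnoncrit _ hmem.2.1.2.1 hg.1).and
      ((continuousAt_refl hmem.2.1.1).eventually (hnoncrit _ hmem.2.1.2.2 hg.2))
  filter_upwards [h3, h4, eventually_reg hz.1] with x e1 e2 e3
  refine ⟨e3, ?_⟩
  rw [e1]
  rintro _ ⟨i, rfl⟩
  exact e2 i

/-- A bad point spoils only the finitely many points of its own fiber. -/
theorem IsSymbol.countable_compl_generic (hφ : IsSymbol φ) : (generic φ)ᶜ.Countable := by
  have hbad : {w | ¬ (Good φ w ∧ deriv φ w ≠ 0)}.Countable :=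
    (hφ.countable_not_good.union hφ.countable_critical).mono fun w hw => by
      by_cases h : Good φ w
      · exact Or.inr (not_not.1 fun h' => hw ⟨h, h'⟩)
      · exact Or.inl h
  refine (hφ.countable_not_reg.union ((hbad.union (countable_refl_preimage hbad)).biUnion
    fun w _ => (hφ.finite_fiber w).countable)).mono fun z hz => ?_
  by_contra h
  simp only [mem_union, not_or, mem_iUnion, not_exists] at h
  have hreg : Reg φ z := by simpa using h.1
  refine hz ⟨hreg, fun w hw => ?_⟩
  by_contra hw'
  rw [not_and_or] at hw'
  exact h.2 w (hw'.imp id id) (mem_fiber_symm hw)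

/-- The number of branches is locally constant, and the generic set is connected because its
complement is countable. -/
theorem exists_ncard_fiber (hφ : IsSymbol φ) : ∃ d, ∀ z ∈ generic φ, (fiber φ z).ncard = d := by
  have hpre : IsPreconnected (generic φ) := by
    simpa using isPreconnected_compl_of_countable hφ.countable_compl_generic
  by_cases hne : (generic φ).Nonempty
  swap
  · exact ⟨0, fun z hz => absurd ⟨z, hz⟩ hne⟩
  obtain ⟨z₀, hz₀⟩ := hne
  refine ⟨(fiber φ z₀).ncard, fun z hz => ?_⟩
  have hloc : ∀ z ∈ generic φ, ∀ᶠ w in 𝓝 z, (fiber φ w).ncard = (fiber φ z).ncard := by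
    intro z hz
    obtain ⟨d, ρ, h1, h2, h3⟩ := good_of_generic hz
    have hev := eventually_injective (fun i => (h1 i).continuousAt) h2
    filter_upwards [h3, hev] with w e1 e2
    rw [e1, h3.self_of_nhds, ← image_univ, ← image_univ, ncard_image_of_injective _ e2,
      ncard_image_of_injective _ h2]
  refine hpre.constant (Y := ℕ) (f := fun z => (fiber φ z).ncard) (fun z hz => ?_) hz hz₀
  refine ContinuousAt.continuousWithinAt ?_
  exact (tendsto_pure.2 (hloc z hz)).mono_right (pure_le_nhds _)

end

/-! ### Products over fibers and invariance of the disk. -/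

section

open Filter Topology Set Metric

variable {φ : ℂ → ℂ}

theorem good_representation {z : ℂ} (hz : z ∈ generic φ) :
    ∃ (d : ℕ) (ρ : Fin d → ℂ → ℂ), (∀ i, AnalyticAt ℂ (ρ i) z) ∧
      ∀ᶠ x in 𝓝 z, fiber φ x = (range fun i => ρ i x) ∧ Function.Injective fun i => ρ i x := by
  obtain ⟨d, ρ, h1, h2, h3⟩ := good_of_generic hz
  exact ⟨d, ρ, h1, h3.and (eventually_injective (fun i => (h1 i).continuousAt) h2)⟩

/-- The product of `f` over the fiber of `z`. -/
noncomputable def fiberProd (φ f : ℂ → ℂ) (z : ℂ) : ℂ := ∏ᶠ w ∈ fiber φ z, f w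

theorem fiberProd_eq_of_range {f : ℂ → ℂ} {z : ℂ} {d : ℕ} {ρ : Fin d → ℂ → ℂ}
    (h : fiber φ z = range fun i => ρ i z) (hinj : Function.Injective fun i => ρ i z) :
    fiberProd φ f z = ∏ i, f (ρ i z) := by
  rw [fiberProd, h, finprod_mem_range hinj, finprod_eq_prod_of_fintype]

theorem fiberProd_eq_of_mem {f : ℂ → ℂ} {z w : ℂ} (h : w ∈ fiber φ z) :
    fiberProd φ f w = fiberProd φ f z := by
  rw [fiberProd, fiberProd, fiber_eq_of_mem h]

theorem IsSymbol.fiberProd_eq_prod (hφ : IsSymbol φ) (f : ℂ → ℂ) (z : ℂ) :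
    fiberProd φ f z = ∏ w ∈ (hφ.finite_fiber z).toFinset, f w :=
  finprod_mem_eq_finite_toFinset_prod _ _

theorem IsSymbol.norm_fiberProd_le (hφ : IsSymbol φ) {f : ℂ → ℂ} {z : ℂ} {C : ℝ}
    (h : ∀ w ∈ fiber φ z, ‖f w‖ ≤ C) : ‖fiberProd φ f z‖ ≤ C ^ (fiber φ z).ncard := by
  rw [hφ.fiberProd_eq_prod, norm_prod, ncard_eq_toFinset_card _ (hφ.finite_fiber z)]
  refine (Finset.prod_le_prod (g := fun _ => C) (fun _ _ => norm_nonneg _) fun w hw => h w ?_).trans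
    (by simp)
  simpa using hw

theorem IsSymbol.pow_le_norm_fiberProd (hφ : IsSymbol φ) {f : ℂ → ℂ} {z : ℂ} {c : ℝ} (hc : 0 ≤ c)
    (h : ∀ w ∈ fiber φ z, c ≤ ‖f w‖) : c ^ (fiber φ z).ncard ≤ ‖fiberProd φ f z‖ := by
  rw [hφ.fiberProd_eq_prod, norm_prod, ncard_eq_toFinset_card _ (hφ.finite_fiber z),
    ← Finset.prod_const]
  refine Finset.prod_le_prod (fun _ _ => hc) fun w hw => h w ?_
  simpa using hw

theorem IsSymbol.fiberProd_eq_mul (hφ : IsSymbol φ) {f : ℂ → ℂ} {z : ℂ} (hz : Reg φ z) :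
    fiberProd φ f z = f z * ∏ w ∈ (hφ.finite_fiber z).toFinset.erase z, f w := by
  rw [hφ.fiberProd_eq_prod, Finset.mul_prod_erase]
  simpa using mem_fiber_self hz

theorem IsSymbol.fiberProd_mul_refl (hφ : IsSymbol φ) {f : ℂ → ℂ} (z : ℂ)
    (hf : ∀ w ∈ fiber φ z, f w * (starRingEnd ℂ) (f (refl w)) = 1) :
    fiberProd φ f z * (starRingEnd ℂ) (fiberProd φ f (refl z)) = 1 := by
  have h1 : fiberProd φ f (SymbolCurve.refl z) =
      ∏ w ∈ (hφ.finite_fiber z).toFinset, f (SymbolCurve.refl w) := by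
    rw [fiberProd, fiber_refl, finprod_mem_image refl_injective.injOn,
      finprod_mem_eq_finite_toFinset_prod]
  rw [h1, hφ.fiberProd_eq_prod, map_prod, ← Finset.prod_mul_distrib]
  exact Finset.prod_eq_one fun w hw => hf w (by simpa using hw)

/-- The product does not depend on the order of the branches, so it is holomorphic on the generic
set whatever their monodromy. It is bounded by `C ^ d`, so the countable complement is removable. -/
theorem IsSymbol.exists_extension_fiberProd (hφ : IsSymbol φ) {f : ℂ → ℂ} {r C : ℝ}
    (hf : ∀ z ∈ generic φ, ‖z‖ < r → ∀ w ∈ fiber φ z, AnalyticAt ℂ f w ∧ ‖f w‖ ≤ C) :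
    ∃ F : ℂ → ℂ, AnalyticOnNhd ℂ F (ball 0 r) ∧
      ∀ z ∈ generic φ, ‖z‖ < r → F z = fiberProd φ f z := by
  obtain ⟨d, hd⟩ := exists_ncard_fiber hφ
  have hset : ball (0 : ℂ) r \ (generic φ)ᶜ = ball 0 r ∩ generic φ := by
    rw [sdiff_eq, compl_compl]
  obtain ⟨F, hF, hFh⟩ := exists_extension_of_countable (U := ball (0 : ℂ) r) (A := (generic φ)ᶜ)
    (h := fiberProd φ f) (C := C ^ d) isOpen_ball hφ.countable_compl_generic
    (by rw [hset]; exact isOpen_ball.inter isOpen_generic)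
    (by
      rw [hset]
      rintro z ⟨hzr, hz⟩
      obtain ⟨m, ρ, h1, h2⟩ := good_representation hz
      have han : AnalyticAt ℂ (fun x => ∏ i, f (ρ i x)) z := by
        refine Finset.analyticAt_fun_prod _ fun i _ => AnalyticAt.fun_comp ?_ (h1 i)
        refine (hf z hz (by simpa using hzr) _ ?_).1
        rw [h2.self_of_nhds.1]; exact ⟨i, rfl⟩
      refine (han.congr ?_).differentiableAt.differentiableWithinAt
      filter_upwards [h2] with x hx using (fiberProd_eq_of_range hx.1 hx.2).symm)
    (by
      rw [hset]
      rintro z ⟨hzr, hz⟩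
      have h := hφ.norm_fiberProd_le (f := f) (C := C)
        fun w hw => (hf z hz (by simpa using hzr) w hw).2
      rwa [hd z hz] at h)
  refine ⟨F, hF.analyticOnNhd isOpen_ball, fun z hz hzr => hFh ?_⟩
  rw [hset]
  exact ⟨by simpa using hzr, hz⟩

theorem dense_circle_of_countable {A : Set ℂ} (hA : A.Countable) :
    Dense {w : Circle | (w : ℂ) ∉ A} := by
  have hpt : ∀ a : ℂ, {t : ℝ | (Circle.exp t : ℂ) = a}.Countable := by
    intro a
    by_cases h : ∃ t₀ : ℝ, (Circle.exp t₀ : ℂ) = a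
    · obtain ⟨t₀, ht₀⟩ := h
      refine (countable_range fun n : ℤ => t₀ + n * (2 * Real.pi)).mono fun t ht => ?_
      have : Circle.exp t = Circle.exp t₀ := Circle.ext (ht.trans ht₀.symm)
      obtain ⟨n, hn⟩ := Circle.exp_eq_exp.1 this
      exact ⟨n, hn.symm⟩
    · push Not at h
      convert countable_empty
      ext t; simpa using h t
  have hpre : {t : ℝ | (Circle.exp t : ℂ) ∈ A}.Countable := by
    refine (hA.biUnion fun a _ => hpt a).mono fun t ht => ?_
    exact mem_iUnion₂.2 ⟨_, ht, rfl⟩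
  have h := Circle.exp_surjective.denseRange.dense_image Circle.exp.continuous
    (hpre.dense_compl ℝ)
  refine h.mono ?_
  rintro _ ⟨t, ht, rfl⟩
  exact ht

/-- A continuous function on the circle that is unimodular off a countable set is unimodular. -/
theorem norm_eq_one_of_countable {F : ℂ → ℂ} {A : Set ℂ} (hA : A.Countable)
    (hF : ∀ z : ℂ, ‖z‖ = 1 → ContinuousAt F z) (h : ∀ z : ℂ, ‖z‖ = 1 → z ∉ A → ‖F z‖ = 1)
    {z : ℂ} (hz : ‖z‖ = 1) : ‖F z‖ = 1 := by
  have hc : Continuous fun w : Circle => ‖F w‖ := by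
    rw [continuous_iff_continuousAt]
    intro w
    exact (ContinuousAt.comp (g := F) (f := ((↑) : Circle → ℂ)) (hF w (Circle.norm_coe w))
      continuous_subtype_val.continuousAt).norm
  have hcl : IsClosed {w : Circle | ‖F w‖ = 1} := isClosed_eq hc continuous_const
  have hsub : {w : Circle | (w : ℂ) ∉ A} ⊆ {w : Circle | ‖F w‖ = 1} :=
    fun w hw => h w (Circle.norm_coe w) hw
  exact hcl.closure_subset_iff.2 hsub
    (dense_circle_of_countable hA (⟨z, mem_sphere_zero_iff_norm.2 hz⟩ : Circle))

theorem norm_le_one_of_norm_eq_one {F : ℂ → ℂ} (hF : AnalyticOnNhd ℂ F (closedBall 0 1))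
    (h1 : ∀ z : ℂ, ‖z‖ = 1 → ‖F z‖ = 1) {z : ℂ} (hz : ‖z‖ ≤ 1) : ‖F z‖ ≤ 1 := by
  refine Complex.norm_le_of_forall_mem_frontier_norm_le (U := ball (0 : ℂ) 1) isBounded_ball
    ?_ (fun w hw => ?_) (by rw [closure_ball _ one_ne_zero]; simpa using hz)
  · refine DifferentiableOn.diffContOnCl ?_
    rw [closure_ball _ one_ne_zero]
    exact hF.differentiableOn
  · rw [frontier_ball _ one_ne_zero] at hw
    exact (h1 w (by simpa using hw)).le

theorem norm_lt_one_of_norm_eq_one {F : ℂ → ℂ} (hF : AnalyticOnNhd ℂ F (closedBall 0 1))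
    (h1 : ∀ z : ℂ, ‖z‖ = 1 → ‖F z‖ = 1) {z₀ : ℂ} (hz₀ : ‖z₀‖ < 1) (h0 : F z₀ = 0)
    {z : ℂ} (hz : ‖z‖ < 1) : ‖F z‖ < 1 := by
  refine lt_of_le_of_ne (norm_le_one_of_norm_eq_one hF h1 hz.le) fun heq => ?_
  have hb : EqOn F (Function.const ℂ (F z)) (ball 0 1) := by
    refine Complex.eqOn_of_isPreconnected_of_isMaxOn_norm (convex_ball 0 1).isPreconnected
      isOpen_ball (hF.differentiableOn.mono ball_subset_closedBall) (by simpa using hz) ?_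
    intro w hw
    show ‖F w‖ ≤ ‖F z‖
    rw [heq]
    exact norm_le_one_of_norm_eq_one hF h1 (mem_ball_zero_iff.1 hw).le
  have := hb (show z₀ ∈ ball (0 : ℂ) 1 by simpa using hz₀)
  rw [h0, Function.const_apply] at this
  rw [← this] at heq
  simp at heq

theorem frequently_generic (hφ : IsSymbol φ) (z : ℂ) : ∃ᶠ w in 𝓝 z, w ∈ generic φ := by
  have h := (dense_compl_of_countable hφ.countable_compl_generic) z
  rw [compl_compl] at h
  exact mem_closure_iff_frequently.1 h

/-- The symmetrized product of a bounded function vanishing at a point of the disk shows that the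
disk is invariant under the identifications. -/
theorem IsSymbol.norm_lt_one_of_bounded (hφ : IsSymbol φ) {f : ℂ → ℂ} {r C : ℝ} (hr : 1 < r)
    (hf : ∀ z ∈ generic φ, ‖z‖ < r → ∀ w ∈ fiber φ z, AnalyticAt ℂ f w ∧ ‖f w‖ ≤ C)
    (hfs : ∀ w, Reg φ w → f w * (starRingEnd ℂ) (f (refl w)) = 1)
    {z₀ : ℂ} (hz₀ : ‖z₀‖ < 1) (hc : ContinuousAt f z₀) (h0 : f z₀ = 0)
    {z w : ℂ} (hz : z ∈ generic φ) (hz1 : ‖z‖ < 1) (hw : w ∈ fiber φ z) : ‖w‖ < 1 := by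
  obtain ⟨d, hd⟩ := exists_ncard_fiber hφ
  obtain ⟨F, hF, hFh⟩ := hφ.exists_extension_fiberProd hf
  have hsub : closedBall (0 : ℂ) 1 ⊆ ball 0 r := closedBall_subset_ball hr
  -- Points of the circle are fixed by `refl`, so the reflection identity reads `F z * conj (F z) =
  -- 1`.
  have hT : ∀ z : ℂ, ‖z‖ = 1 → ‖F z‖ = 1 := fun z hz => by
    refine norm_eq_one_of_countable hφ.countable_compl_generic
      (fun z hz => (hF z (hsub (by simp [hz]))).continuousAt) (fun z hz hzg => ?_) hz
    have hzg : z ∈ generic φ := not_not.1 hzg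
    have h := hφ.fiberProd_mul_refl z fun w hw => hfs w hw.2.1
    rw [refl_eq_self hz, ← hFh z hzg (by rw [hz]; exact hr), Complex.mul_conj,
      Complex.normSq_eq_norm_sq] at h
    have h' : ‖F z‖ ^ 2 = 1 := by exact_mod_cast h
    exact (pow_eq_one_iff_of_nonneg (norm_nonneg _) two_ne_zero).1 h'
  -- The point `z₀` need not be generic. At generic points nearby one factor is the small number `f
  -- z`, and the others are bounded; `max C 1` allows their number to be replaced by `d`.
  have hFz₀ : F z₀ = 0 := by
    by_contra hne
    have hcF : ContinuousAt F z₀ := (hF z₀ (by simp; linarith)).continuousAt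
    have hlim : Tendsto (fun z => ‖f z‖ * (max C 1) ^ d) (𝓝 z₀) (𝓝 0) := by
      have := (hc.norm.tendsto.mul_const ((max C 1) ^ d))
      simpa [h0] using this
    have hgt : ∀ᶠ z in 𝓝 z₀, ‖f z‖ * (max C 1) ^ d < ‖F z₀‖ / 2 :=
      hlim.eventually_lt_const (by have := norm_pos_iff.2 hne; linarith)
    have hgt' : ∀ᶠ z in 𝓝 z₀, ‖F z₀‖ / 2 < ‖F z‖ :=
      hcF.norm.eventually_const_lt (by have := norm_pos_iff.2 hne; linarith)
    have hball : ∀ᶠ z in 𝓝 z₀, ‖z‖ < r :=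
      continuous_norm.continuousAt.eventually_lt_const (by linarith)
    obtain ⟨z, hzg, h1, h2, h3⟩ :=
      ((frequently_generic hφ z₀).and_eventually (hgt.and (hgt'.and hball))).exists
    have hle : ‖F z‖ ≤ ‖f z‖ * (max C 1) ^ d := by
      rw [hFh z hzg h3, hφ.fiberProd_eq_mul hzg.1, norm_mul, norm_prod]
      refine mul_le_mul_of_nonneg_left ?_ (norm_nonneg _)
      refine (Finset.prod_le_prod (g := fun _ => max C 1) (fun _ _ => norm_nonneg _)
        fun w hw => ?_).trans ?_
      · have hw : w ∈ fiber φ z := by simpa using (Finset.mem_erase.1 hw).2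
        exact (hf z hzg h3 w hw).2.trans (le_max_left _ _)
      · rw [Finset.prod_const]
        refine pow_le_pow_right₀ (le_max_right _ _) ?_
        rw [← hd z hzg, ncard_eq_toFinset_card _ (hφ.finite_fiber z)]
        exact Finset.card_le_card (Finset.erase_subset _ _)
    linarith
  have hF' : AnalyticOnNhd ℂ F (closedBall 0 1) := fun z hz => hF z (hsub hz)
  have hlt : ∀ z : ℂ, ‖z‖ < 1 → ‖F z‖ < 1 :=
    fun z hz => norm_lt_one_of_norm_eq_one hF' hT hz₀ hFz₀ hz
  have hwg := generic_of_mem_fiber hz hw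
  -- If `w` is on the circle then `F w = F z` has modulus both one and less than one. If `w` is
  -- outside, `F z * conj (F (refl w)) = 1` is a product of two numbers of modulus less than one.
  by_contra hge
  rcases (not_lt.1 hge).eq_or_lt with h1 | h1
  · have h2 : F w = F z := by
      rw [hFh w hwg (by rw [← h1]; exact hr), hFh z hz (by linarith), fiberProd_eq_of_mem hw]
    have h3 := hlt z hz1
    rw [← h2, hT w h1.symm] at h3
    exact lt_irrefl _ h3
  · have hrw : ‖SymbolCurve.refl w‖ < 1 := by
      rw [norm_refl]; exact inv_lt_one_of_one_lt₀ h1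
    have h2 := hφ.fiberProd_mul_refl z fun w hw => hfs w hw.2.1
    rw [← fiberProd_eq_of_mem (refl_mem_fiber hw), ← hFh z hz (by linarith),
      ← hFh _ (refl_mem_generic hwg) (by linarith)] at h2
    have h3 := congrArg norm h2
    rw [norm_mul, Complex.norm_conj, norm_one] at h3
    have h4 := hlt z hz1
    have h5 := hlt _ hrw
    nlinarith [norm_nonneg (F z), norm_nonneg (F (SymbolCurve.refl w))]

/-- The Blaschke factor vanishing at `a`. -/
noncomputable def bfac (a w : ℂ) : ℂ := (w - a) / (1 - (starRingEnd ℂ) a * w)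

theorem analyticAt_bfac {a w : ℂ} (h : 1 - (starRingEnd ℂ) a * w ≠ 0) :
    AnalyticAt ℂ (bfac a) w :=
  AnalyticAt.fun_div (by fun_prop) (by fun_prop) h

theorem one_sub_conj_mul_eq {a w : ℂ} (ha : a ≠ 0) :
    1 - (starRingEnd ℂ) a * w = -(starRingEnd ℂ) a * (w - refl a) := by
  have : (starRingEnd ℂ) a ≠ 0 := by simpa using ha
  simp only [refl]; field_simp; ring

theorem bfac_mul_refl {a w : ℂ} (ha : a ≠ 0) (hw : w ≠ 0) (h1 : w ≠ a) (h2 : w ≠ refl a) :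
    bfac a w * (starRingEnd ℂ) (bfac a (refl w)) = 1 := by
  have h3 : w - a ≠ 0 := sub_ne_zero.2 h1
  have h4 : 1 - (starRingEnd ℂ) a * w ≠ 0 := by
    rw [one_sub_conj_mul_eq ha]
    exact mul_ne_zero (by simpa using ha) (sub_ne_zero.2 h2)
  simp only [bfac, refl, map_div₀, map_sub, map_mul, map_inv₀, Complex.conj_conj, map_one]
  have h5 : 1 - a * w⁻¹ = (w - a) * w⁻¹ := by field_simp
  have h6 : w⁻¹ - (starRingEnd ℂ) a = (1 - (starRingEnd ℂ) a * w) * w⁻¹ := by field_simp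
  rw [h5, h6, div_mul_div_comm,
    div_eq_one_iff_eq (mul_ne_zero h4 (mul_ne_zero h3 (inv_ne_zero hw)))]
  ring

theorem exists_norm_bfac_le {a : ℂ} (ha : a ≠ 0) {δ : ℝ} (hδ : 0 < δ) :
    ∃ C, ∀ w, δ ≤ ‖w - refl a‖ → ‖bfac a w‖ ≤ C := by
  refine ⟨(1 + ‖refl a - a‖ / δ) / ‖a‖, fun w hw => ?_⟩
  have h1 : 0 < ‖w - refl a‖ := hδ.trans_le hw
  rw [bfac, one_sub_conj_mul_eq ha, norm_div, norm_mul, norm_neg, Complex.norm_conj]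
  have h2 : ‖w - a‖ ≤ ‖w - refl a‖ + ‖refl a - a‖ := by
    simpa using norm_add_le (w - refl a) (refl a - a)
  have ha' : 0 < ‖a‖ := norm_pos_iff.2 ha
  rw [div_le_div_iff₀ (by positivity) ha']
  have h3 : ‖refl a - a‖ ≤ ‖refl a - a‖ / δ * ‖w - refl a‖ := by
    rw [div_mul_eq_mul_div, le_div_iff₀ hδ]
    exact mul_le_mul_of_nonneg_left hw (norm_nonneg _)
  nlinarith

theorem IsSymbol.exists_radius (hφ : IsSymbol φ) :
    ∃ r > 1, ∃ M, ∀ z, ‖z‖ ≤ r → AnalyticAt ℂ φ z ∧ ‖φ z‖ ≤ M := by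
  obtain ⟨δ, hδ, hsub⟩ := (isCompact_closedBall (0 : ℂ) 1).exists_cthickening_subset_open
    (isOpen_analyticAt ℂ φ) hφ.holomorphic
  rw [cthickening_closedBall hδ.le zero_le_one] at hsub
  have hc : ContinuousOn φ (closedBall 0 (1 + δ)) := fun z hz =>
    ContinuousAt.continuousWithinAt (AnalyticAt.continuousAt (hsub (by rwa [add_comm])))
  obtain ⟨M, hM⟩ := (isCompact_closedBall (0 : ℂ) (1 + δ)).exists_bound_of_continuousOn hc
  refine ⟨1 + δ, by linarith, M, fun z hz => ⟨hsub ?_, hM z (by simpa using hz)⟩⟩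
  rw [add_comm]; simpa using hz

/-- If `φ` is entire, the points identified with points of the disk stay in a bounded set. -/
theorem IsSymbol.exists_bound_fiber (hφ : IsSymbol φ) (hent : ∀ z, AnalyticAt ℂ φ z) :
    ∃ r > 1, ∃ C, ∀ z ∈ generic φ, ‖z‖ < r → ∀ w ∈ fiber φ z, ‖w‖ ≤ C := by
  have hd : Differentiable ℂ φ := fun z => (hent z).differentiableAt
  have hcont : Continuous φ := hd.continuous
  -- The radius `s` is chosen so that `φ` avoids the value `φ 0` on the circle of radius `s`; then
  -- so does a neighbourhood of that value.
  obtain ⟨s, ⟨hs0, hs1⟩, hs⟩ : ∃ s ∈ Ioo (0 : ℝ) 1,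
      s ∉ norm '' {z ∈ closedBall (0 : ℂ) 1 | φ z = φ 0} :=
    ((Ioo_infinite one_pos).exists_notMem_finite ((hφ.finite_level (φ 0)).image norm))
  have hne : ∀ v ∈ sphere (0 : ℂ) s, φ v - φ 0 ≠ 0 := by
    intro v hv h
    have hv : ‖v‖ = s := by simpa using hv
    exact hs ⟨v, ⟨by simp [hv, hs1.le], sub_eq_zero.1 h⟩, hv⟩
  obtain ⟨η, hη, hηs⟩ : ∃ η > 0, ∀ v ∈ sphere (0 : ℂ) s, η ≤ ‖φ v - φ 0‖ := by
    obtain ⟨v, hv, hmin⟩ := (isCompact_sphere (0 : ℂ) s).exists_isMinOn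
      ((NormedSpace.sphere_nonempty (x := (0 : ℂ))).2 hs0.le)
      (f := fun v => ‖φ v - φ 0‖) (by fun_prop)
    exact ⟨_, norm_pos_iff.2 (hne v hv), fun w hw => hmin hw⟩
  obtain ⟨ε, hε, hεb⟩ := Metric.continuousAt_iff.1 (hcont.continuousAt (x := 0)) η hη
  refine ⟨s⁻¹, (one_lt_inv₀ hs0).2 hs1, ε⁻¹, ?_⟩
  set Ω : Set ℂ := {w : ℂ | ε⁻¹ < ‖w‖} \ (generic φ)ᶜ with hΩ
  have hΩp : IsPreconnected Ω :=
    isPreconnected_exterior_diff hφ.countable_compl_generic (inv_nonneg.2 hε.le)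
  -- For `w` far out, `φ (refl w)` is too close to `φ 0` for `refl z` to have modulus `s`.
  have hsph : ∀ w ∈ Ω, ∀ z ∈ fiber φ w, ‖z‖ ≠ s⁻¹ := by
    rintro w ⟨hw, -⟩ z hz hzs
    have hw : ε⁻¹ < ‖w‖ := hw
    have h1 := hηs (SymbolCurve.refl z) (by simp [hzs])
    have h2 : dist (SymbolCurve.refl w) 0 < ε := by
      simpa using inv_lt_of_inv_lt₀ hε hw
    have h3 := hεb h2
    rw [dist_eq_norm, ← hz.2.2.2] at h3
    linarith
  classical
  -- No branch crosses the circle of radius `s⁻¹`, so whether a fiber meets the disk inside it is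
  -- locally constant on the connected set `Ω`.
  have hloc : ∀ x ∈ Ω, ∀ y ∈ Ω, (∃ z ∈ fiber φ x, ‖z‖ < s⁻¹) → ∃ z ∈ fiber φ y, ‖z‖ < s⁻¹ := by
    intro x hx y hy hxx
    have hconst := hΩp.constant (Y := ℕ)
      (f := fun w => if ∃ z ∈ fiber φ w, ‖z‖ < s⁻¹ then 1 else 0) (fun w hw => ?_) hx hy
    · by_contra hyy
      simp only [hxx, hyy, if_true, if_false] at hconst
      exact one_ne_zero hconst
    refine ContinuousAt.continuousWithinAt ?_
    refine (tendsto_pure.2 ?_).mono_right (pure_le_nhds _)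
    obtain ⟨d, ρ, h1, h2⟩ := good_representation (not_not.1 hw.2)
    have h3 : ∀ᶠ v in 𝓝 w, ∀ i, (‖ρ i v‖ < s⁻¹ ↔ ‖ρ i w‖ < s⁻¹) := by
      refine eventually_all.2 fun i => ?_
      have hi : ρ i w ∈ fiber φ w := by rw [h2.self_of_nhds.1]; exact ⟨i, rfl⟩
      have hcn : ContinuousAt (fun v => ‖ρ i v‖) w := (h1 i).continuousAt.norm
      rcases lt_or_gt_of_ne (hsph w hw _ hi) with h | h
      · filter_upwards [hcn.eventually_lt_const h] with v hv
        exact iff_of_true hv h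
      · filter_upwards [hcn.eventually_const_lt h] with v hv
        exact iff_of_false (not_lt.2 hv.le) (not_lt.2 h.le)
    filter_upwards [h2, h3] with v e1 e2
    have hiff : (∃ z ∈ fiber φ v, ‖z‖ < s⁻¹) ↔ ∃ z ∈ fiber φ w, ‖z‖ < s⁻¹ := by
      rw [e1.1, h2.self_of_nhds.1, exists_range_iff, exists_range_iff]
      exact exists_congr e2
    simp only [hiff]
  -- If one far fiber meets that disk then all do, every far value of `φ` is taken in a fixed
  -- compact disk, and Liouville's theorem makes `φ` constant.
  by_cases hall : ∃ w ∈ Ω, ∃ z ∈ fiber φ w, ‖z‖ < s⁻¹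
  · exfalso
    obtain ⟨w₀, hw₀, hzz⟩ := hall
    obtain ⟨M, hM⟩ := (isCompact_closedBall (0 : ℂ) s⁻¹).exists_bound_of_continuousOn
      hcont.continuousOn
    obtain ⟨M', hM'⟩ := (isCompact_closedBall (0 : ℂ) ε⁻¹).exists_bound_of_continuousOn
      hcont.continuousOn
    have hb : ∀ w : ℂ, ‖φ w‖ ≤ max M M' := by
      intro w
      rcases le_or_gt ‖w‖ ε⁻¹ with h | h
      · exact (hM' w (by simpa using h)).trans (le_max_right _ _)
      refine le_trans ?_ (le_max_left _ _)
      by_contra! hlt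
      have e1 : ∀ᶠ v in 𝓝 w, M < ‖φ v‖ := hcont.norm.continuousAt.eventually_const_lt hlt
      have e2 : ∀ᶠ v in 𝓝 w, ε⁻¹ < ‖v‖ := continuous_norm.continuousAt.eventually_const_lt h
      obtain ⟨v, hv, hv1, hv2⟩ := ((frequently_generic hφ w).and_eventually (e1.and e2)).exists
      obtain ⟨z, hz, hzs⟩ := hloc w₀ hw₀ v ⟨hv2, not_not.2 hv⟩ hzz
      have := hM z (by simpa using hzs.le)
      rw [hz.2.2.1] at this
      linarith
    refine hφ.nonconst ⟨φ 0, fun z _ => hd.apply_eq_apply_of_bounded ?_ z 0⟩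
    refine isBounded_iff_forall_norm_le.2 ⟨max M M', ?_⟩
    rintro _ ⟨w, rfl⟩
    exact hb w
  · intro z hz hzs w hw
    by_contra! hlt
    exact hall ⟨w, ⟨hlt, not_not.2 (generic_of_mem_fiber hz hw)⟩, z, mem_fiber_symm hw, hzs⟩

/-- The identifications preserve the open disk. -/
theorem IsSymbol.norm_lt_one_of_mem_fiber (hφ : IsSymbol φ) {z w : ℂ} (hz : z ∈ generic φ)
    (hz1 : ‖z‖ < 1) (hw : w ∈ fiber φ z) : ‖w‖ < 1 := by
  by_cases hent : ∀ z, AnalyticAt ℂ φ z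
  · obtain ⟨r, hr, C, hC⟩ := hφ.exists_bound_fiber hent
    refine hφ.norm_lt_one_of_bounded (f := id) hr
      (fun z hz hzr w hw => ⟨analyticAt_id, hC z hz hzr w hw⟩) (fun w hw => ?_) (z₀ := 0)
      (by simp) continuousAt_id rfl hz hz1 hw
    have : w ≠ 0 := hw.1
    simp [SymbolCurve.refl, this]
  · push Not at hent
    obtain ⟨p, hp⟩ := hent
    have hp1 : 1 < ‖p‖ := by
      by_contra! h
      exact hp (hφ.holomorphic p (by simpa using h))
    have hp0 : p ≠ 0 := by
      rintro rfl; simp at hp1; linarith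
    have ha0 : SymbolCurve.refl p ≠ 0 := by simpa using hp0
    have ha1 : ‖SymbolCurve.refl p‖ < 1 := by
      rw [norm_refl]; exact inv_lt_one_of_one_lt₀ hp1
    obtain ⟨r, hr, M, hM⟩ := hφ.exists_radius
    -- Near the pole `|φ|` exceeds its bound `M` on the disk of radius `r`, so fibers over that disk
    -- avoid a neighbourhood of `p`, the only pole of the chosen Blaschke factor.
    have hpole : ∀ᶠ v in 𝓝[≠] p, M < ‖φ v‖ :=
      (tendsto_norm_atTop_iff_cobounded.2 ((hφ.pole p).resolve_left hp)).eventually_gt_atTop _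
    rw [eventually_nhdsWithin_iff, Metric.eventually_nhds_iff_ball] at hpole
    obtain ⟨δ, hδ, hδb⟩ := hpole
    obtain ⟨C, hC⟩ := exists_norm_bfac_le ha0 hδ
    have hreg : ∀ w, Reg φ w → w ≠ p ∧ w ≠ SymbolCurve.refl p := by
      refine fun w hw => ⟨?_, ?_⟩
      · rintro rfl; exact hp hw.2.1
      · rintro rfl; exact hp (by simpa using hw.2.2)
    refine hφ.norm_lt_one_of_bounded (f := bfac (SymbolCurve.refl p)) hr
      (C := C) (fun z hz hzr w hw => ⟨analyticAt_bfac ?_, hC w ?_⟩) (fun w hw => ?_)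
      (z₀ := SymbolCurve.refl p) ha1 (analyticAt_bfac ?_).continuousAt (by simp [bfac]) hz hz1 hw
    · rw [one_sub_conj_mul_eq ha0, refl_refl]
      exact mul_ne_zero (by simpa using hp0) (sub_ne_zero.2 (hreg w hw.2.1).1)
    · rw [refl_refl]
      by_contra! hlt
      have h1 := hδb w (by rwa [mem_ball, dist_eq_norm]) (hreg w hw.2.1).1
      rw [hw.2.2.1] at h1
      linarith [(hM z hzr.le).2]
    · exact bfac_mul_refl ha0 hw.1 (hreg w hw).2 (by rw [refl_refl]; exact (hreg w hw).1)
    · exact one_sub_conj_mul_ne_zero ha1 ha1.le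

theorem IsSymbol.one_lt_norm_of_mem_fiber (hφ : IsSymbol φ) {z w : ℂ} (hz : z ∈ generic φ)
    (hz1 : 1 < ‖z‖) (hw : w ∈ fiber φ z) : 1 < ‖w‖ := by
  have h := hφ.norm_lt_one_of_mem_fiber (refl_mem_generic hz)
    (by rw [norm_refl]; exact inv_lt_one_of_one_lt₀ hz1) (refl_mem_fiber hw)
  rw [norm_refl] at h
  exact (inv_lt_one₀ (norm_pos_iff.2 hw.2.1.1)).1 h

theorem IsSymbol.norm_eq_one_of_mem_fiber (hφ : IsSymbol φ) {z w : ℂ} (hz : z ∈ generic φ)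
    (hz1 : ‖z‖ = 1) (hw : w ∈ fiber φ z) : ‖w‖ = 1 := by
  have hwg := generic_of_mem_fiber hz hw
  rcases lt_trichotomy ‖w‖ 1 with h | h | h
  · have := hφ.norm_lt_one_of_mem_fiber hwg h (mem_fiber_symm hw); linarith
  · exact h
  · have := hφ.one_lt_norm_of_mem_fiber hwg h (mem_fiber_symm hw); linarith

end

/-! ### Finite Blaschke products: levels, argument and valence on the circle. -/

section

open Filter Topology Set Metric Polynomial

/-- The sign of the right side decides on which side of the circle a Blaschke factor sends `z`. -/
theorem norm_sq_sub_norm_sq (a z : ℂ) :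
    ‖z - a‖ ^ 2 - ‖1 - (starRingEnd ℂ) a * z‖ ^ 2 = (‖z‖ ^ 2 - 1) * (1 - ‖a‖ ^ 2) := by
  simp only [← Complex.normSq_eq_norm_sq, Complex.normSq_apply, Complex.sub_re, Complex.sub_im,
    Complex.mul_re, Complex.mul_im, Complex.conj_re, Complex.conj_im, Complex.one_re,
    Complex.one_im]
  ring

theorem one_le_norm_bfac {a z : ℂ} (ha : ‖a‖ < 1) (hz : 1 ≤ ‖z‖)
    (hd : 1 - (starRingEnd ℂ) a * z ≠ 0) : 1 ≤ ‖bfac a z‖ := by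
  have h := norm_sq_sub_norm_sq a z
  have hd : 0 < ‖1 - (starRingEnd ℂ) a * z‖ := norm_pos_iff.2 hd
  rw [bfac, norm_div, one_le_div hd]
  have h1 : 0 < 1 - ‖a‖ ^ 2 := by nlinarith [norm_nonneg a]
  have h2 : 0 ≤ ‖z‖ ^ 2 - 1 := by nlinarith
  refine (pow_le_pow_iff_left₀ (norm_nonneg _) (norm_nonneg _) two_ne_zero).1 ?_
  nlinarith [mul_nonneg h2 h1.le]

theorem one_lt_norm_bfac {a z : ℂ} (ha : ‖a‖ < 1) (hz : 1 < ‖z‖)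
    (hd : 1 - (starRingEnd ℂ) a * z ≠ 0) : 1 < ‖bfac a z‖ := by
  have h := norm_sq_sub_norm_sq a z
  have hd : 0 < ‖1 - (starRingEnd ℂ) a * z‖ := norm_pos_iff.2 hd
  rw [bfac, norm_div, one_lt_div hd]
  have h1 : 0 < 1 - ‖a‖ ^ 2 := by nlinarith [norm_nonneg a]
  have h2 : 0 < ‖z‖ ^ 2 - 1 := by nlinarith
  refine lt_of_pow_lt_pow_left₀ 2 (norm_nonneg _) ?_
  nlinarith [mul_pos h2 h1]

theorem norm_bfac_eq_one {a z : ℂ} (ha : ‖a‖ < 1) (hz : ‖z‖ = 1) : ‖bfac a z‖ = 1 := by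
  have hd := norm_pos_iff.2 (one_sub_conj_mul_ne_zero ha hz.le)
  rw [bfac, norm_div, ← norm_one_sub_conj_mul hz, div_self hd.ne']

/-- The finite Blaschke product with zeros `a i`. -/
noncomputable def blaschke {m : ℕ} (c : ℂ) (a : Fin m → ℂ) (z : ℂ) : ℂ := c * ∏ i, bfac (a i) z

section
variable {m : ℕ} {c : ℂ} {a : Fin m → ℂ}

theorem isBlaschkeOfOrder_blaschke (hc : ‖c‖ = 1) (ha : ∀ i, ‖a i‖ < 1) :
    IsBlaschkeOfOrder (blaschke c a) m := ⟨c, a, hc, ha, fun _ => rfl⟩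

theorem IsBlaschkeOfOrder.exists_eq {B : ℂ → ℂ} (h : IsBlaschkeOfOrder B m) :
    ∃ (c : ℂ) (a : Fin m → ℂ), ‖c‖ = 1 ∧ (∀ i, ‖a i‖ < 1) ∧ B = blaschke c a := by
  obtain ⟨c, a, hc, ha, hB⟩ := h
  exact ⟨c, a, hc, ha, funext hB⟩

theorem analyticAt_blaschke {z : ℂ} (hz : ∀ i, 1 - (starRingEnd ℂ) (a i) * z ≠ 0) :
    AnalyticAt ℂ (blaschke c a) z :=
  analyticAt_const.fun_mul (Finset.analyticAt_fun_prod _ fun i _ => analyticAt_bfac (hz i))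

theorem analyticOnNhd_blaschke (ha : ∀ i, ‖a i‖ < 1) :
    AnalyticOnNhd ℂ (blaschke c a) (closedBall 0 1) := fun z hz =>
  analyticAt_blaschke fun i => one_sub_conj_mul_ne_zero (ha i) (by simpa using hz)

theorem norm_blaschke_eq_one (hc : ‖c‖ = 1) (ha : ∀ i, ‖a i‖ < 1) {z : ℂ} (hz : ‖z‖ = 1) :
    ‖blaschke c a z‖ = 1 := by
  rw [blaschke, norm_mul, hc, one_mul, norm_prod]
  exact Finset.prod_eq_one fun i _ => norm_bfac_eq_one (ha i) hz

theorem norm_blaschke_lt_one (hm : 0 < m) (hc : ‖c‖ = 1) (ha : ∀ i, ‖a i‖ < 1) {z : ℂ}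
    (hz : ‖z‖ < 1) : ‖blaschke c a z‖ < 1 := by
  refine norm_lt_one_of_norm_eq_one (analyticOnNhd_blaschke ha)
    (fun z hz => norm_blaschke_eq_one hc ha hz) (ha ⟨0, hm⟩) ?_ hz
  rw [blaschke, Finset.prod_eq_zero (Finset.mem_univ ⟨0, hm⟩) (by simp [bfac]), mul_zero]

theorem one_le_norm_blaschke (hc : ‖c‖ = 1) (ha : ∀ i, ‖a i‖ < 1) {z : ℂ} (hz : 1 ≤ ‖z‖)
    (hd : ∀ i, 1 - (starRingEnd ℂ) (a i) * z ≠ 0) : 1 ≤ ‖blaschke c a z‖ := by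
  rw [blaschke, norm_mul, hc, one_mul, norm_prod]
  calc (1 : ℝ) = ∏ _i : Fin m, 1 := by simp
    _ ≤ _ := Finset.prod_le_prod (fun _ _ => zero_le_one)
      fun i _ => one_le_norm_bfac (ha i) hz (hd i)

theorem one_lt_norm_blaschke (hm : 0 < m) (hc : ‖c‖ = 1) (ha : ∀ i, ‖a i‖ < 1) {z : ℂ}
    (hz : 1 < ‖z‖) (hd : ∀ i, 1 - (starRingEnd ℂ) (a i) * z ≠ 0) : 1 < ‖blaschke c a z‖ := by
  rw [blaschke, norm_mul, hc, one_mul, norm_prod]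
  have : Nonempty (Fin m) := ⟨⟨0, hm⟩⟩
  calc (1 : ℝ) = ∏ _i : Fin m, 1 := by simp
    _ < _ := Finset.prod_lt_prod_of_nonempty (fun _ _ => zero_lt_one)
      (fun i _ => one_lt_norm_bfac (ha i) hz (hd i)) Finset.univ_nonempty

theorem natDegree_one_sub_C_mul_X_le (b : ℂ) : (1 - C b * X : ℂ[X]).natDegree ≤ 1 := by
  compute_degree

/-- The polynomial whose roots are the solutions of `blaschke c a z = β`. -/
noncomputable def blaschkePoly (c : ℂ) (a : Fin m → ℂ) (β : ℂ) : ℂ[X] :=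
  C c * ∏ i, (X - C (a i)) - C β * ∏ i, (1 - C ((starRingEnd ℂ) (a i)) * X)

theorem eval_blaschkePoly (β z : ℂ) : (blaschkePoly c a β).eval z =
    c * ∏ i, (z - a i) - β * ∏ i, (1 - (starRingEnd ℂ) (a i) * z) := by
  simp [blaschkePoly, eval_prod]

theorem eval_blaschkePoly_eq (β : ℂ) {z : ℂ} (hd : ∀ i, 1 - (starRingEnd ℂ) (a i) * z ≠ 0) :
    (blaschkePoly c a β).eval z =
      (blaschke c a z - β) * ∏ i, (1 - (starRingEnd ℂ) (a i) * z) := by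
  have : ∏ i, (1 - (starRingEnd ℂ) (a i) * z) ≠ 0 := Finset.prod_ne_zero_iff.2 fun i _ => hd i
  simp only [eval_blaschkePoly, blaschke, bfac, Finset.prod_div_distrib]
  rw [sub_mul, mul_assoc, div_mul_cancel₀ _ this]

theorem coeff_blaschkePoly (β : ℂ) : (blaschkePoly c a β).coeff m =
    c - β * ∏ i, (-(starRingEnd ℂ) (a i)) := by
  have h1 := coeff_prod_of_natDegree_le Finset.univ (fun i => (X - C (a i) : ℂ[X])) 1
    (fun i _ => natDegree_X_sub_C_le _)
  have h2 := coeff_prod_of_natDegree_le Finset.univ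
    (fun i => (1 - C ((starRingEnd ℂ) (a i)) * X : ℂ[X])) 1
    (fun i _ => natDegree_one_sub_C_mul_X_le _)
  simp only [Finset.card_univ, Fintype.card_fin, mul_one] at h1 h2
  rw [blaschkePoly, coeff_sub, coeff_C_mul, coeff_C_mul, h1, h2]
  simp [coeff_X, coeff_C, coeff_one]

theorem natDegree_blaschkePoly_le (β : ℂ) : (blaschkePoly c a β).natDegree ≤ m := by
  refine (natDegree_sub_le _ _).trans (max_le ?_ ?_)
  · refine (natDegree_C_mul_le _ _).trans ((natDegree_prod_le _ _).trans ?_)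
    simp
  · refine (natDegree_C_mul_le _ _).trans ((natDegree_prod_le _ _).trans ?_)
    refine (Finset.sum_le_sum (g := fun _ => 1) fun i _ => ?_).trans (by simp)
    exact natDegree_one_sub_C_mul_X_le _

/-- The top coefficient is nonzero since `|β| ∏ |a i| < 1 = |c|`; here `0 < m` makes the product
less than one. -/
theorem natDegree_blaschkePoly (hm : 0 < m) (hc : ‖c‖ = 1) (ha : ∀ i, ‖a i‖ < 1) {β : ℂ}
    (hβ : ‖β‖ ≤ 1) : (blaschkePoly c a β).natDegree = m ∧ blaschkePoly c a β ≠ 0 := by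
  have hcoeff : (blaschkePoly c a β).coeff m ≠ 0 := by
    rw [coeff_blaschkePoly, sub_ne_zero]
    intro h
    have h1 := congrArg norm h
    rw [hc, norm_mul, norm_prod] at h1
    have h2 : ∏ i, ‖-(starRingEnd ℂ) (a i)‖ < 1 := by
      have h3 : ∏ i, ‖-(starRingEnd ℂ) (a i)‖ ≤ ‖-(starRingEnd ℂ) (a ⟨0, hm⟩)‖ := by
        rw [← Finset.mul_prod_erase _ _ (Finset.mem_univ ⟨0, hm⟩)]
        refine mul_le_of_le_one_right (norm_nonneg _) ?_
        exact Finset.prod_le_one (fun _ _ => norm_nonneg _) fun i _ => by simpa using (ha i).le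
      refine h3.trans_lt (by simpa using ha _)
    have h4 : 0 ≤ ∏ i, ‖-(starRingEnd ℂ) (a i)‖ := Finset.prod_nonneg fun _ _ => norm_nonneg _
    nlinarith [norm_nonneg β]
  exact ⟨le_antisymm (natDegree_blaschkePoly_le β) (le_natDegree_of_ne_zero hcoeff),
    fun h => hcoeff (by rw [h, coeff_zero])⟩

theorem card_roots_blaschkePoly (hm : 0 < m) (hc : ‖c‖ = 1) (ha : ∀ i, ‖a i‖ < 1) {β : ℂ}
    (hβ : ‖β‖ ≤ 1) : (blaschkePoly c a β).roots.card = m := by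
  rw [← (IsAlgClosed.splits (blaschkePoly c a β)).natDegree_eq_card_roots]
  exact (natDegree_blaschkePoly hm hc ha hβ).1

/-- Roots of `blaschkePoly` are not poles of the Blaschke product. -/
theorem one_sub_ne_zero_of_root (hc : ‖c‖ = 1) (ha : ∀ i, ‖a i‖ < 1) {β z : ℂ}
    (hz : (blaschkePoly c a β).eval z = 0) (i : Fin m) : 1 - (starRingEnd ℂ) (a i) * z ≠ 0 := by
  intro h
  rw [eval_blaschkePoly,
    Finset.prod_eq_zero (f := fun i => 1 - (starRingEnd ℂ) (a i) * z) (Finset.mem_univ i) h, mul_zero, sub_zero,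
    mul_eq_zero, Finset.prod_eq_zero_iff] at hz
  rcases hz with h0 | ⟨j, -, hj⟩
  · simp [h0] at hc
  · have hzj : z = a j := sub_eq_zero.1 hj
    exact one_sub_conj_mul_ne_zero (ha i) (hzj ▸ (ha j).le) h

theorem blaschke_eq_of_root (hc : ‖c‖ = 1) (ha : ∀ i, ‖a i‖ < 1) {β z : ℂ}
    (hz : (blaschkePoly c a β).eval z = 0) : blaschke c a z = β := by
  have hd := one_sub_ne_zero_of_root hc ha hz
  rw [eval_blaschkePoly_eq β hd, mul_eq_zero] at hz
  exact sub_eq_zero.1 (hz.resolve_right (Finset.prod_ne_zero_iff.2 fun i _ => hd i))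

theorem norm_lt_one_of_root (hc : ‖c‖ = 1) (ha : ∀ i, ‖a i‖ < 1) {β z : ℂ}
    (hβ : ‖β‖ < 1) (hz : (blaschkePoly c a β).eval z = 0) : ‖z‖ < 1 := by
  by_contra! h
  have := one_le_norm_blaschke hc ha h (one_sub_ne_zero_of_root hc ha hz)
  rw [blaschke_eq_of_root hc ha hz] at this
  linarith

theorem norm_eq_one_of_root (hm : 0 < m) (hc : ‖c‖ = 1) (ha : ∀ i, ‖a i‖ < 1) {β z : ℂ}
    (hβ : ‖β‖ = 1) (hz : (blaschkePoly c a β).eval z = 0) : ‖z‖ = 1 := by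
  have hB := blaschke_eq_of_root hc ha hz
  rcases lt_trichotomy ‖z‖ 1 with h | h | h
  · have := norm_blaschke_lt_one hm hc ha h
    rw [hB, hβ] at this; exact absurd this (lt_irrefl _)
  · exact h
  · have := one_lt_norm_blaschke hm hc ha h (one_sub_ne_zero_of_root hc ha hz)
    rw [hB, hβ] at this; exact absurd this (lt_irrefl _)

theorem ncard_blaschke_le (hm : 0 < m) (hc : ‖c‖ = 1) (ha : ∀ i, ‖a i‖ < 1) {β : ℂ}
    (hβ : ‖β‖ ≤ 1) : {z ∈ closedBall (0 : ℂ) 1 | blaschke c a z = β}.Finite ∧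
      {z ∈ closedBall (0 : ℂ) 1 | blaschke c a z = β}.ncard ≤ m := by
  classical
  have hne := (natDegree_blaschkePoly hm hc ha hβ).2
  have hsub : {z ∈ closedBall (0 : ℂ) 1 | blaschke c a z = β} ⊆
      ((blaschkePoly c a β).roots.toFinset : Set ℂ) := by
    rintro z ⟨hz, h⟩
    rw [Finset.mem_coe, Multiset.mem_toFinset, mem_roots hne, IsRoot, eval_blaschkePoly_eq β
      fun i => one_sub_conj_mul_ne_zero (ha i) (by simpa using hz), h, sub_self, zero_mul]
  refine ⟨(Finset.finite_toSet _).subset hsub, (ncard_le_ncard hsub).trans ?_⟩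
  rw [ncard_coe_finset]
  exact (Multiset.toFinset_card_le _).trans (card_roots_blaschkePoly hm hc ha hβ).le

/-- The speed of the argument of a Blaschke factor along the circle. -/
noncomputable def poisson (a : ℂ) (t : ℝ) : ℝ := (1 - ‖a‖ ^ 2) / ‖(Circle.exp t : ℂ) - a‖ ^ 2

theorem circle_sub_ne_zero {a : ℂ} (ha : ‖a‖ < 1) (t : ℝ) : (Circle.exp t : ℂ) - a ≠ 0 := by
  intro h
  have := congrArg norm (sub_eq_zero.1 h)
  rw [Circle.norm_coe] at this
  linarith

theorem poisson_pos {a : ℂ} (ha : ‖a‖ < 1) (t : ℝ) : 0 < poisson a t := by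
  have := norm_pos_iff.2 (circle_sub_ne_zero ha t)
  have h1 : 0 < 1 - ‖a‖ ^ 2 := by nlinarith [norm_nonneg a]
  unfold poisson; positivity

theorem continuous_poisson {a : ℂ} (ha : ‖a‖ < 1) : Continuous (poisson a) := by
  unfold poisson
  refine Continuous.div (by fun_prop) (by fun_prop) fun t => ?_
  exact pow_ne_zero _ (norm_ne_zero_iff.2 (circle_sub_ne_zero ha t))

theorem hasDerivAt_circle_exp (t : ℝ) :
    HasDerivAt (fun t : ℝ => (Circle.exp t : ℂ)) (Complex.I * Circle.exp t) t := by
  simp only [Circle.coe_exp]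
  have := ((hasDerivAt_id t).ofReal_comp.mul_const Complex.I).cexp
  refine this.congr_deriv ?_
  simp [mul_comm]

/-- On the circle `1 - conj a * z = z * conj (z - a)`, which makes the logarithmic derivative purely
imaginary, namely `i` times the Poisson kernel. -/
theorem hasDerivAt_bfac_circle {a : ℂ} (ha : ‖a‖ < 1) (t : ℝ) :
    HasDerivAt (fun t : ℝ => bfac a (Circle.exp t))
      (bfac a (Circle.exp t) * (Complex.I * poisson a t)) t := by
  obtain ⟨z, hz⟩ : ∃ z : ℂ, z = (Circle.exp t : ℂ) := ⟨_, rfl⟩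
  have hz1 : ‖z‖ = 1 := by rw [hz]; exact Circle.norm_coe _
  have hd : 1 - (starRingEnd ℂ) a * z ≠ 0 := one_sub_conj_mul_ne_zero ha hz1.le
  have hn : z - a ≠ 0 := by rw [hz]; exact circle_sub_ne_zero ha t
  have hzc : z * (starRingEnd ℂ) z = 1 := by
    rw [Complex.mul_conj, Complex.normSq_eq_norm_sq, hz1]; simp
  have h1 := hasDerivAt_circle_exp t
  have h2 := (h1.sub_const a).fun_div ((h1.const_mul ((starRingEnd ℂ) a)).const_sub 1) (by rw [← hz]; exact hd)
  refine h2.congr_deriv ?_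
  rw [← hz]
  have e1 : ((‖z - a‖ ^ 2 : ℝ) : ℂ) = (z - a) * (starRingEnd ℂ) (z - a) := by
    rw [Complex.mul_conj, Complex.normSq_eq_norm_sq]
  have e2 : ((‖a‖ ^ 2 : ℝ) : ℂ) = a * (starRingEnd ℂ) a := by
    rw [Complex.mul_conj, Complex.normSq_eq_norm_sq]
  have e3 : 1 - (starRingEnd ℂ) a * z = z * (starRingEnd ℂ) (z - a) := by
    rw [map_sub, mul_sub, hzc]; ring
  have hz0 : z ≠ 0 := fun h => by simp [h] at hz1
  have hcn : (starRingEnd ℂ) (z - a) ≠ 0 := (_root_.map_ne_zero _).2 hn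
  have e4 : ((poisson a t : ℝ) : ℂ) =
      (1 - a * (starRingEnd ℂ) a) / ((z - a) * (starRingEnd ℂ) (z - a)) := by
    rw [← e1, ← e2, poisson, ← hz]; push_cast; rfl
  rw [e4, bfac, e3]
  have e5 : Complex.I * z * (z * (starRingEnd ℂ) (z - a)) -
      (z - a) * -((starRingEnd ℂ) a * (Complex.I * z)) =
      Complex.I * z * (1 - a * (starRingEnd ℂ) a) := by
    rw [← e3]; ring
  rw [e5]
  field_simp

/-- The continuous increasing argument of a Blaschke product along the circle. -/
theorem exists_argument (hm : 0 < m) (ha : ∀ i, ‖a i‖ < 1) :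
    ∃ θ κ : ℝ → ℝ, (∀ t, HasDerivAt θ (κ t) t) ∧ (∀ t, 0 < κ t) ∧
      (∀ t, κ (t + 2 * Real.pi) = κ t) ∧
      ∀ t : ℝ, blaschke c a (Circle.exp t) = blaschke c a 1 * Complex.exp (Complex.I * θ t) := by
  have hθ : ∀ i, ∃ θ : ℝ → ℝ, (∀ t, HasDerivAt θ (poisson (a i) t) t) ∧
      ∀ t : ℝ, bfac (a i) (Circle.exp t) = bfac (a i) 1 * Complex.exp (Complex.I * θ t) := by
    intro i
    have hcont := continuous_poisson (ha i)
    set θ : ℝ → ℝ := fun t => ∫ s in (0 : ℝ)..t, poisson (a i) s with hθ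
    have hd : ∀ t, HasDerivAt θ (poisson (a i) t) t := fun t =>
      (hcont.integral_hasStrictDerivAt 0 t).hasDerivAt
    refine ⟨θ, hd, fun t => ?_⟩
    have hconst : ∀ t, HasDerivAt (fun t : ℝ => bfac (a i) (Circle.exp t) *
        Complex.exp (-(Complex.I * θ t))) 0 t := by
      intro t
      have h1 := (((hd t).ofReal_comp.const_mul Complex.I).fun_neg).cexp
      refine ((hasDerivAt_bfac_circle (ha i) t).fun_mul h1).congr_deriv ?_
      ring
    have h := is_const_of_deriv_eq_zero (fun t => (hconst t).differentiableAt)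
      (fun t => (hconst t).deriv) t 0
    have hθ0 : θ 0 = 0 := by simp [hθ]
    simp only [hθ0, Circle.exp_zero, Complex.ofReal_zero, mul_zero, neg_zero, Complex.exp_zero,
      mul_one, Circle.coe_one] at h
    rw [← h, mul_assoc, ← Complex.exp_add]
    simp
  choose θ hθd hθe using hθ
  have : Nonempty (Fin m) := ⟨⟨0, hm⟩⟩
  refine ⟨fun t => ∑ i, θ i t, fun t => ∑ i, poisson (a i) t,
    fun t => HasDerivAt.fun_sum fun i _ => hθd i t,
    fun t => Finset.sum_pos (fun i _ => poisson_pos (ha i) t) Finset.univ_nonempty,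
    fun t => by simp [poisson, Circle.exp_add], fun t => ?_⟩
  simp only [blaschke]
  rw [Finset.prod_congr rfl fun i _ => hθe i t, Finset.prod_mul_distrib, ← Complex.exp_sum]
  push_cast
  rw [Finset.mul_sum, mul_assoc]

/-- A critical point on the circle would stop the argument, whose speed is strictly positive. -/
theorem deriv_blaschke_ne_zero (hm : 0 < m) (hc : ‖c‖ = 1) (ha : ∀ i, ‖a i‖ < 1) {z : ℂ}
    (hz : ‖z‖ = 1) : deriv (blaschke c a) z ≠ 0 := by
  obtain ⟨t, ht⟩ := Circle.exp_surjective (⟨z, mem_sphere_zero_iff_norm.2 hz⟩ : Circle)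
  have ht' : (Circle.exp t : ℂ) = z := by rw [ht]
  obtain ⟨θ, κ, h1, h2, -, h3⟩ := exists_argument (c := c) hm ha
  intro h0
  have hd : HasDerivAt (blaschke c a) 0 (Circle.exp t : ℂ) := by
    have := (analyticOnNhd_blaschke (c := c) ha z (by simp [hz])).differentiableAt.hasDerivAt
    rwa [h0, ← ht'] at this
  have hd1 := hd.comp_of_eq t (hasDerivAt_circle_exp t) rfl
  have hd2 := (((h1 t).ofReal_comp.const_mul Complex.I).cexp).const_mul (blaschke c a 1)
  have heq : (blaschke c a ∘ fun t : ℝ => (Circle.exp t : ℂ)) =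
      fun t : ℝ => blaschke c a 1 * Complex.exp (Complex.I * θ t) := funext h3
  rw [heq] at hd1
  have h4 := hd1.unique hd2
  have h5 : blaschke c a 1 ≠ 0 := fun h => by
    have := norm_blaschke_eq_one hc ha (z := 1) (by simp)
    rw [h] at this; simp at this
  have h6 : ((κ t : ℝ) : ℂ) ≠ 0 := by exact_mod_cast (h2 t).ne'
  rw [zero_mul] at h4
  exact mul_ne_zero h5 (mul_ne_zero (Complex.exp_ne_zero _) (mul_ne_zero Complex.I_ne_zero h6))
    h4.symm

/-- A Blaschke product of order `m` takes every unimodular value exactly `m` times on the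
circle. -/
theorem encard_blaschke_circle (hm : 0 < m) (hc : ‖c‖ = 1) (ha : ∀ i, ‖a i‖ < 1) {β : ℂ}
    (hβ : ‖β‖ = 1) : {w : Circle | blaschke c a w = β}.encard = m := by
  classical
  set p := blaschkePoly c a β with hp
  have hne : p ≠ 0 := (natDegree_blaschkePoly hm hc ha hβ.le).2
  -- All `m` roots lie on the circle, and a double root would be a critical point of the Blaschke
  -- product there.
  have hnodup : p.roots.Nodup := by
    rw [Multiset.nodup_iff_count_le_one]
    intro z
    rw [count_roots]
    by_contra! hlt
    obtain ⟨h1, h2⟩ := (one_lt_rootMultiplicity_iff_isRoot hne).1 hlt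
    have hz := norm_eq_one_of_root hm hc ha hβ h1
    have hd : ∀ i, 1 - (starRingEnd ℂ) (a i) * z ≠ 0 :=
      fun i => one_sub_conj_mul_ne_zero (ha i) hz.le
    have hev : (fun w => p.eval w) =ᶠ[𝓝 z]
        fun w => (blaschke c a w - β) * ∏ i, (1 - (starRingEnd ℂ) (a i) * w) := by
      have : ∀ᶠ w in 𝓝 z, ∀ i, 1 - (starRingEnd ℂ) (a i) * w ≠ 0 :=
        eventually_all.2 fun i => ContinuousAt.eventually_ne (by fun_prop) (hd i)
      filter_upwards [this] with w hw using eval_blaschkePoly_eq β hw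
    have hB : HasDerivAt (fun w => (blaschke c a w - β) * ∏ i, (1 - (starRingEnd ℂ) (a i) * w)) _ z :=
      ((analyticOnNhd_blaschke (c := c) ha z (by simp [hz])).differentiableAt.hasDerivAt.sub_const
        β).fun_mul (DifferentiableAt.hasDerivAt (by fun_prop))
    have hE := (p.hasDerivAt z).congr_of_eventuallyEq hev.symm
    have h3 := hE.unique hB
    rw [blaschke_eq_of_root hc ha h1, sub_self, zero_mul, add_zero, h2.eq_zero] at h3
    exact mul_ne_zero (deriv_blaschke_ne_zero hm hc ha hz)
      (Finset.prod_ne_zero_iff.2 fun i _ => hd i) h3.symm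
  have himg : (fun w : Circle => (w : ℂ)) '' {w : Circle | blaschke c a w = β} =
      (p.roots.toFinset : Set ℂ) := by
    ext z
    rw [Finset.mem_coe, Multiset.mem_toFinset, mem_roots hne]
    constructor
    · rintro ⟨w, hw, rfl⟩
      have hw : blaschke c a w = β := hw
      rw [IsRoot, hp, eval_blaschkePoly_eq β fun i => one_sub_conj_mul_ne_zero (ha i)
        (Circle.norm_coe w).le, hw, sub_self, zero_mul]
    · intro hz
      exact ⟨⟨z, mem_sphere_zero_iff_norm.2 (norm_eq_one_of_root hm hc ha hβ hz)⟩,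
        blaschke_eq_of_root hc ha hz, rfl⟩
  have hinj : Function.Injective fun w : Circle => (w : ℂ) := fun _ _ h => Circle.ext h
  rw [← hinj.encard_image, himg, encard_coe_eq_coe_finsetCard,
    Multiset.toFinset_card_of_nodup hnodup, card_roots_blaschkePoly hm hc ha hβ.le]

end

end

/-! ### The Blaschke product attached to the symbol. -/

section

open Filter Topology Set Metric

variable {φ : ℂ → ℂ}

/-- Points of a closed set disjoint from the fiber of a generic point `a` are not identified with
points near `a`. -/
theorem exists_dist_of_disjoint {a : ℂ} (ha : a ∈ generic φ) {K : Set ℂ} (hK : IsClosed K)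
    (hd : ∀ w ∈ fiber φ a, w ∉ K) : ∃ δ > 0, ∀ z ∈ K, ∀ w ∈ fiber φ z, δ ≤ ‖w - a‖ := by
  obtain ⟨m, ρ, h1, h2⟩ := good_representation ha
  have h3 : ∀ᶠ u in 𝓝 a, ∀ i, ρ i u ∈ Kᶜ := by
    refine eventually_all.2 fun i => (h1 i).continuousAt.eventually (hK.isOpen_compl.mem_nhds ?_)
    exact hd _ (by rw [h2.self_of_nhds.1]; exact ⟨i, rfl⟩)
  obtain ⟨δ, hδ, hb⟩ := Metric.eventually_nhds_iff_ball.1 (h2.and h3)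
  refine ⟨δ, hδ, fun z hz w hw => ?_⟩
  by_contra! hlt
  obtain ⟨e1, e2⟩ := hb w (by rwa [mem_ball, dist_eq_norm])
  have := mem_fiber_symm hw
  rw [e1.1] at this
  obtain ⟨i, rfl⟩ := this
  exact e2 i hz

theorem deriv_mul_of_zero {u v : ℂ → ℂ} {x : ℂ} (hu : AnalyticAt ℂ u x) (hv : AnalyticAt ℂ v x)
    (h0 : u x = 0) : HasDerivAt (fun z => u z * v z) (deriv u x * v x) x := by
  have := hu.differentiableAt.hasDerivAt.fun_mul hv.differentiableAt.hasDerivAt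
  rwa [h0, zero_mul, add_zero] at this

/-- A symmetrized Blaschke factor based at a generic point is a finite Blaschke product whose order
is at most the number of points in the fibers. -/
theorem IsSymbol.exists_blaschke_fiberProd (hφ : IsSymbol φ) {a : ℂ} (ha : a ∈ generic φ)
    (ha1 : ‖a‖ < 1) : ∃ (m : ℕ) (c : ℂ) (b : Fin m → ℂ), m ≤ (fiber φ a).ncard ∧ ‖c‖ = 1 ∧
      (∀ i, ‖b i‖ < 1) ∧
      ∀ z ∈ generic φ, ‖z‖ ≤ 1 → blaschke c b z = fiberProd φ (bfac a) z := by
  have ha0 : a ≠ 0 := ha.1.1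
  have hra : SymbolCurve.refl a ∈ generic φ := refl_mem_generic ha
  have hra1 : 1 < ‖SymbolCurve.refl a‖ := by
    rw [norm_refl]; exact (one_lt_inv₀ (norm_pos_iff.2 ha0)).2 ha1
  -- The fiber of the pole `refl a` is finite and strictly outside the closed disk. A slightly
  -- larger disk still misses it, so fibers over that disk keep a distance from the pole.
  obtain ⟨r, hr, hrf⟩ : ∃ r > 1, ∀ w ∈ fiber φ (SymbolCurve.refl a), r < ‖w‖ := by
    have hev : ∀ᶠ r in 𝓝[>] (1 : ℝ), ∀ w ∈ fiber φ (SymbolCurve.refl a), r < ‖w‖ := by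
      rw [(hφ.finite_fiber _).eventually_all]
      intro w hw
      exact nhdsWithin_le_nhds (eventually_lt_nhds (hφ.one_lt_norm_of_mem_fiber hra hra1 hw))
    obtain ⟨r, h1, h2⟩ := (hev.and self_mem_nhdsWithin).exists
    exact ⟨r, h2, h1⟩
  obtain ⟨δ, hδ, hδa⟩ := exists_dist_of_disjoint hra (isClosed_closedBall (x := (0 : ℂ)) (ε := r))
    (fun w hw hwr => absurd (hrf w hw) (not_lt.2 (by simpa using hwr)))
  obtain ⟨C, hC⟩ := exists_norm_bfac_le ha0 hδ
  obtain ⟨F, hF, hFh⟩ := hφ.exists_extension_fiberProd (f := bfac a) (r := r) (C := C)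
    (fun z _ hzr w hw => by
      have hw' := hδa z (by simpa using hzr.le) w hw
      refine ⟨analyticAt_bfac ?_, hC w hw'⟩
      rw [one_sub_conj_mul_eq ha0]
      exact mul_ne_zero (by simpa using ha0) (norm_pos_iff.1 (hδ.trans_le hw')))
  have hsub : closedBall (0 : ℂ) 1 ⊆ ball 0 r := closedBall_subset_ball hr
  have hF' : AnalyticOnNhd ℂ F (closedBall 0 1) := fun z hz => hF z (hsub hz)
  have hT : ∀ z : ℂ, ‖z‖ = 1 → ‖F z‖ = 1 := fun z hz => by
    refine norm_eq_one_of_countable hφ.countable_compl_generic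
      (fun z hz => (hF z (hsub (by simp [hz]))).continuousAt) (fun z hz hzg => ?_) hz
    have hzg : z ∈ generic φ := not_not.1 hzg
    rw [hFh z hzg (by rw [hz]; exact hr), hφ.fiberProd_eq_prod, norm_prod]
    refine Finset.prod_eq_one fun w hw => norm_bfac_eq_one ha1 ?_
    exact hφ.norm_eq_one_of_mem_fiber hzg hz (by simpa using hw)
  obtain ⟨m, c, b, hc, hb, hFB⟩ := exists_blaschke hF' hT
  have hFB' : ∀ z ∈ closedBall (0 : ℂ) 1, F z = blaschke c b z := hFB
  have hnear : ∀ i, ∀ᶠ z in 𝓝 (b i), ‖z‖ < 1 := fun i =>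
    continuous_norm.continuousAt.eventually_lt_const (hb i)
  have hFb : ∀ i, F (b i) = 0 := by
    intro i
    rw [hFB' _ (by simpa using (hb i).le), blaschke,
      Finset.prod_eq_zero (Finset.mem_univ i) (by simp [bfac]), mul_zero]
  -- Away from the fiber of `a`, fibers stay at distance `η` from `a`. As `|1 - conj a * w| ≤ 2`,
  -- each factor is at least `η / 2`, so `F` cannot vanish there.
  have hmem : ∀ i, b i ∈ fiber φ a := by
    intro i
    by_contra hx
    obtain ⟨ε, hε, hεb⟩ := Metric.mem_nhds_iff.1 ((hφ.finite_fiber a).isClosed.isOpen_compl.mem_nhds hx)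
    obtain ⟨η, hη, hηa⟩ := exists_dist_of_disjoint ha
      (isClosed_closedBall (x := b i) (ε := ε / 2)) (fun w hw hwr =>
        hεb (closedBall_subset_ball (half_lt_self hε) hwr) hw)
    obtain ⟨d, hd⟩ := exists_ncard_fiber hφ
    have hcF : ContinuousAt F (b i) := (hF' _ (by simpa using (hb i).le)).continuousAt
    have hsmall : ∀ᶠ z in 𝓝 (b i), ‖F z‖ < (η / 2) ^ d := by
      refine hcF.norm.eventually_lt_const ?_
      show ‖F (b i)‖ < _
      rw [hFb i, norm_zero]; positivity
    obtain ⟨z, hzg, h1, h2, h3⟩ := ((frequently_generic hφ (b i)).and_eventually (hsmall.and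
      ((hnear i).and (closedBall_mem_nhds (b i) (half_pos hε))))).exists
    have hle := hφ.pow_le_norm_fiberProd (z := z) (f := bfac a) (c := η / 2) (by positivity) (by
      intro w hw
      have hw1 := hφ.norm_lt_one_of_mem_fiber hzg h2 hw
      have h4 := hηa z h3 w hw
      have h5 := norm_pos_iff.2 (one_sub_conj_mul_ne_zero ha1 hw1.le)
      have h6 : ‖1 - (starRingEnd ℂ) a * w‖ ≤ 2 := by
        refine (norm_sub_le _ _).trans ?_
        rw [norm_one, norm_mul, Complex.norm_conj]
        nlinarith [norm_nonneg a, norm_nonneg w]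
      rw [bfac, norm_div, le_div_iff₀ h5]
      nlinarith)
    rw [hd z hzg, ← hFh z hzg (by linarith)] at hle
    linarith
  -- The zeros are simple. Locally `F` is `ρ k - a` times a nonvanishing factor, and `ρ k` has
  -- nonzero derivative because `φ ∘ ρ k = φ` at a noncritical point.
  have hinj : Function.Injective b := by
    intro i j hij
    by_contra hne
    set x := b i with hx
    have hxg : x ∈ generic φ := generic_of_mem_fiber ha (hmem i)
    have hden : ∀ k, 1 - (starRingEnd ℂ) (b k) * x ≠ 0 := fun k =>
      one_sub_conj_mul_ne_zero (hb k) (hb i).le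
    have hd0 : HasDerivAt F 0 x := by
      have hev : F =ᶠ[𝓝 x] fun z => bfac (b i) z *
          (bfac (b j) z * (c * ∏ k ∈ (Finset.univ.erase i).erase j, bfac (b k) z)) := by
        filter_upwards [hnear i] with z hz
        rw [hFB' z (by simpa using hz.le), blaschke, ← Finset.mul_prod_erase _ _ (Finset.mem_univ i),
          ← Finset.mul_prod_erase (Finset.univ.erase i) _
            (Finset.mem_erase.2 ⟨Ne.symm hne, Finset.mem_univ j⟩)]
        ring
      refine HasDerivAt.congr_of_eventuallyEq ?_ hev
      refine (deriv_mul_of_zero (analyticAt_bfac (hden i)) ((analyticAt_bfac (hden j)).fun_mul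
        (analyticAt_const.fun_mul (Finset.analyticAt_fun_prod _ fun k _ =>
          analyticAt_bfac (hden k)))) (by simp [bfac, hx])).congr_deriv ?_
      rw [← hij]
      simp [bfac]
    obtain ⟨n, ρ, h1, h2⟩ := good_representation hxg
    obtain ⟨k, hk⟩ : ∃ k, ρ k x = a := by
      have h := mem_fiber_symm (hmem i)
      rw [h2.self_of_nhds.1] at h
      exact h
    have hρin : ∀ l, ‖ρ l x‖ < 1 := fun l => hφ.norm_lt_one_of_mem_fiber hxg (hb i)
      (by rw [h2.self_of_nhds.1]; exact ⟨l, rfl⟩)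
    have hban : ∀ l, AnalyticAt ℂ (fun z => bfac a (ρ l z)) x := fun l =>
      AnalyticAt.fun_comp (analyticAt_bfac (one_sub_conj_mul_ne_zero ha1 (hρin l).le)) (h1 l)
    have hev : F =ᶠ[𝓝 x] fun z => (ρ k z - a) * ((1 - (starRingEnd ℂ) a * ρ k z)⁻¹ *
        ∏ l ∈ Finset.univ.erase k, bfac a (ρ l z)) := by
      filter_upwards [h2, hnear i, isOpen_generic.mem_nhds hxg] with z e1 e2 e3
      rw [hFh z e3 (by linarith), fiberProd_eq_of_range e1.1 e1.2,
        ← Finset.mul_prod_erase _ _ (Finset.mem_univ k), ← mul_assoc, bfac, div_eq_mul_inv]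
    have hinv : AnalyticAt ℂ (fun z => (1 - (starRingEnd ℂ) a * ρ k z)⁻¹) x :=
      (analyticAt_const.fun_sub (analyticAt_const.fun_mul (h1 k))).fun_inv
        (one_sub_conj_mul_ne_zero ha1 (hρin k).le)
    have hd1 := (deriv_mul_of_zero ((h1 k).fun_sub analyticAt_const) (hinv.fun_mul
      (Finset.analyticAt_fun_prod (Finset.univ.erase k) fun l _ => hban l))
      (by rw [hk, sub_self])).congr_of_eventuallyEq hev
    have h3 := hd0.unique hd1
    have hφρ : (fun z => φ (ρ k z)) =ᶠ[𝓝 x] φ := by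
      filter_upwards [h2] with z hz
      have : ρ k z ∈ fiber φ z := by rw [hz.1]; exact ⟨k, rfl⟩
      exact this.2.2.1
    have hρ' : deriv (ρ k) x ≠ 0 := by
      intro h0
      have e1 : HasDerivAt φ (deriv φ a) (ρ k x) := by
        rw [hk]; exact ha.1.2.1.differentiableAt.hasDerivAt
      have e2 := e1.comp x (h1 k).differentiableAt.hasDerivAt
      rw [h0, mul_zero] at e2
      exact deriv_ne_zero_of_generic hxg (e2.congr_of_eventuallyEq hφρ.symm).deriv
    refine mul_ne_zero ?_ (mul_ne_zero (inv_ne_zero (one_sub_conj_mul_ne_zero ha1 (hρin k).le))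
      (Finset.prod_ne_zero_iff.2 fun l hl => ?_)) h3.symm
    · simpa using hρ'
    · have hla : ρ l x ≠ a := fun h => (Finset.mem_erase.1 hl).1 (h2.self_of_nhds.2 (h.trans hk.symm))
      exact div_ne_zero (sub_ne_zero.2 hla) (one_sub_conj_mul_ne_zero ha1 (hρin l).le)
  refine ⟨m, c, b, ?_, hc, hb, fun z hz hz1 => ?_⟩
  · have h := ncard_le_ncard (range_subset_iff.2 hmem) (hφ.finite_fiber a)
    rwa [← image_univ, ncard_image_of_injective _ hinj, ncard_univ, Nat.card_fin] at h
  · rw [← hFB' z (by simpa using hz1), hFh z hz (by linarith)]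

theorem eventually_den_ne_zero {m : ℕ} {b : Fin m → ℂ} (hb : ∀ i, ‖b i‖ < 1) {z : ℂ}
    (hz : ‖z‖ ≤ 1) : ∀ᶠ w in 𝓝 z, ∀ i, 1 - (starRingEnd ℂ) (b i) * w ≠ 0 :=
  eventually_all.2 fun i =>
    ContinuousAt.eventually_ne (by fun_prop) (one_sub_conj_mul_ne_zero (hb i) hz)

/-- A Blaschke product of positive order is an open map near the closed disk. -/
theorem nhds_le_map_blaschke {m : ℕ} {c : ℂ} {b : Fin m → ℂ} (hm : 0 < m) (hc : ‖c‖ = 1)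
    (hb : ∀ i, ‖b i‖ < 1) {z : ℂ} (hz : ‖z‖ ≤ 1) :
    𝓝 (blaschke c b z) ≤ map (blaschke c b) (𝓝 z) := by
  have han := analyticOnNhd_blaschke (c := c) hb
  refine ((han z (by simpa using hz)).eventually_constant_or_nhds_le_map_nhds).resolve_left
    fun h => ?_
  have heq := han.eqOn_of_preconnected_of_eventuallyEq
    (g := fun _ => blaschke c b z) (fun _ _ => analyticAt_const)
    (convex_closedBall 0 1).isPreconnected (by simpa using hz) h
  have h0 := heq (show (0 : ℂ) ∈ closedBall (0 : ℂ) 1 by simp)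
  have h1 := heq (show (1 : ℂ) ∈ closedBall (0 : ℂ) 1 by simp)
  have h2 := norm_blaschke_lt_one hm hc hb (z := 0) (by simp)
  have h3 := norm_blaschke_eq_one hc hb (z := 1) (by simp)
  simp only at h0 h1
  rw [h0] at h2
  rw [h1] at h3
  linarith

/-- A generic fiber in the disk has `d` points and is contained in a level of the Blaschke product,
which has at most `m ≤ d`; so the two coincide. The first conclusion follows on the closed disk by
approximation. The second needs only constancy on fibers, since on the circle `φ w = φ z` alone puts
`w` in the fiber of `z`. -/
theorem IsSymbol.exists_blaschke (hφ : IsSymbol φ) :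
    ∃ (m : ℕ) (c : ℂ) (b : Fin m → ℂ), 0 < m ∧ ‖c‖ = 1 ∧ (∀ i, ‖b i‖ < 1) ∧
      (∀ z w : ℂ, ‖z‖ ≤ 1 → ‖w‖ ≤ 1 → blaschke c b z = blaschke c b w → φ z = φ w) ∧
      ∃ A : Set ℂ, A.Countable ∧ ∀ z w : ℂ, ‖z‖ = 1 → ‖w‖ = 1 → z ∉ A → φ w = φ z →
        blaschke c b w = blaschke c b z := by
  obtain ⟨a, ha, ha1⟩ : ∃ a ∈ generic φ, ‖a‖ < 1 := by
    obtain ⟨a, h1, h2⟩ := ((frequently_generic hφ 0).and_eventually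
      (ball_mem_nhds (0 : ℂ) one_pos)).exists
    exact ⟨a, h1, by simpa using h2⟩
  obtain ⟨m, c, b, hmd, hc, hb, hB⟩ := hφ.exists_blaschke_fiberProd ha ha1
  obtain ⟨d, hd⟩ := exists_ncard_fiber hφ
  rw [hd a ha] at hmd
  have hinv : ∀ z ∈ generic φ, ‖z‖ ≤ 1 → ∀ w ∈ fiber φ z, ‖w‖ ≤ 1 →
      blaschke c b w = blaschke c b z := by
    intro z hz hz1 w hw hw1
    rw [hB w (generic_of_mem_fiber hz hw) hw1, hB z hz hz1, fiberProd_eq_of_mem hw]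
  -- An empty product would be the unimodular constant `c`, but the product over the fiber of `a`
  -- contains the factor vanishing at `a`.
  have hm : 0 < m := by
    rcases Nat.eq_zero_or_pos m with rfl | h
    · have h1 := hB a ha ha1.le
      rw [hφ.fiberProd_eq_mul ha.1] at h1
      simp only [blaschke, bfac, sub_self, zero_div, zero_mul, Finset.univ_eq_empty,
        Finset.prod_empty, mul_one] at h1
      simp [h1] at hc
    · exact h
  have hfib : ∀ z ∈ generic φ, ‖z‖ < 1 → ∀ w, ‖w‖ < 1 → blaschke c b w = blaschke c b z →
      w ∈ fiber φ z := by
    intro z hz hz1 w hw1 hwz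
    obtain ⟨h1, h2⟩ := ncard_blaschke_le (c := c) hm hc hb (norm_blaschke_lt_one hm hc hb hz1).le
    have hsub : fiber φ z ⊆
        {w ∈ closedBall (0 : ℂ) 1 | blaschke c b w = blaschke c b z} := fun v hv => by
      have hv1 := hφ.norm_lt_one_of_mem_fiber hz hz1 hv
      exact ⟨by simpa using hv1.le, hinv z hz hz1.le v hv hv1.le⟩
    have := eq_of_subset_of_ncard_le hsub (by rw [hd z hz]; exact h2.trans hmd) h1
    rw [this]
    exact ⟨by simpa using hw1.le, hwz⟩
  refine ⟨m, c, b, hm, hc, hb, fun z w hz hw hzw => ?_, (generic φ)ᶜ,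
    hφ.countable_compl_generic, fun z w hz hw hzA hφzw => ?_⟩
  -- Openness at `w` lifts a generic point `y` of the disk close to `z` to a point `v` close to `w`
  -- on the same level. This `v` is again in the disk, so `φ v = φ y`, although the two values lie
  -- in disjoint neighbourhoods.
  · by_contra hne
    have hcz : ContinuousAt φ z := (hφ.holomorphic z (by simpa using hz)).continuousAt
    have hcw : ContinuousAt φ w := (hφ.holomorphic w (by simpa using hw)).continuousAt
    obtain ⟨U, V, hU, hV, hzU, hwV, hUV⟩ := t2_separation hne
    have hBz : ContinuousAt (blaschke c b) z :=
      (analyticOnNhd_blaschke hb z (by simpa using hz)).continuousAt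
    have hN : {v | φ v ∈ V ∧ ∀ i, 1 - (starRingEnd ℂ) (b i) * v ≠ 0} ∈ 𝓝 w :=
      (hcw.eventually (hV.mem_nhds hwV)).and (eventually_den_ne_zero hb hw)
    have himg : blaschke c b '' {v | φ v ∈ V ∧ ∀ i, 1 - (starRingEnd ℂ) (b i) * v ≠ 0} ∈
        𝓝 (blaschke c b z) := by
      rw [hzw]
      exact nhds_le_map_blaschke hm hc hb hw (image_mem_map hN)
    have hfreq : ∃ᶠ y in 𝓝 z, y ∈ generic φ ∧ ‖y‖ < 1 := by
      have hcl : z ∈ closure (ball (0 : ℂ) 1) := by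
        rw [closure_ball _ one_ne_zero]; simpa using hz
      have hdense : Dense (generic φ) := by
        simpa using dense_compl_of_countable hφ.countable_compl_generic
      have := mem_closure_iff_frequently.1
        (closure_minimal (hdense.open_subset_closure_inter isOpen_ball) isClosed_closure hcl)
      exact this.mono fun y hy => ⟨hy.2, by simpa using hy.1⟩
    obtain ⟨y, ⟨hyg, hy1⟩, hyU, v, ⟨hvV, hvd⟩, hvy⟩ := (hfreq.and_eventually
      ((hcz.eventually (hU.mem_nhds hzU)).and (hBz.eventually himg))).exists
    have hv1 : ‖v‖ < 1 := by
      by_contra! h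
      have h1 := one_le_norm_blaschke hc hb h hvd
      rw [hvy] at h1
      exact absurd (norm_blaschke_lt_one hm hc hb hy1) (not_lt.2 h1)
    have hmem := hfib y hyg hy1 v hv1 hvy
    rw [hmem.2.2.1] at hvV
    exact disjoint_left.1 hUV hyU hvV
  · have hzg : z ∈ generic φ := not_not.1 hzA
    have hmem : w ∈ fiber φ z := ⟨hφ.reg_of_norm_eq_one hz, hφ.reg_of_norm_eq_one hw, hφzw,
      by rw [refl_eq_self hz, refl_eq_self hw, hφzw]⟩
    exact hinv z hzg hz.le w hmem hw.le

end

/-! ### Factoring through a Blaschke product and counting zeros. -/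

section

open Filter Topology Set Metric Polynomial

variable {m : ℕ} {c : ℂ} {b : Fin m → ℂ}

theorem exists_preimage_blaschke (hm : 0 < m) (hc : ‖c‖ = 1) (hb : ∀ i, ‖b i‖ < 1) {β : ℂ}
    (hβ : ‖β‖ < 1) : ∃ z : ℂ, ‖z‖ < 1 ∧ blaschke c b z = β := by
  have hcard := card_roots_blaschkePoly hm hc hb hβ.le
  obtain ⟨z, hz⟩ := Multiset.card_pos_iff_exists_mem.1 (hcard ▸ hm)
  have hz0 := isRoot_of_mem_roots hz
  exact ⟨z, norm_lt_one_of_root hc hb hβ hz0, blaschke_eq_of_root hc hb hz0⟩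

theorem countable_critical_blaschke (hm : 0 < m) (hc : ‖c‖ = 1) (hb : ∀ i, ‖b i‖ < 1) :
    {z ∈ closedBall (0 : ℂ) 1 | deriv (blaschke c b) z = 0}.Countable :=
  countable_zeros (f := deriv (blaschke c b)) (U := closedBall 0 1)
    (fun z hz => (analyticOnNhd_blaschke hb z hz).deriv)
    (convex_closedBall _ _).isPreconnected (x := 1) (by simp)
    (deriv_blaschke_ne_zero hm hc hb (by simp))

/-- A holomorphic function which is constant on the fibers of a finite Blaschke product factors
through it. -/
theorem exists_comp_blaschke (hm : 0 < m) (hc : ‖c‖ = 1) (hb : ∀ i, ‖b i‖ < 1) {f : ℂ → ℂ}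
    (hf : AnalyticOnNhd ℂ f (closedBall 0 1))
    (h : ∀ z w : ℂ, ‖z‖ < 1 → ‖w‖ < 1 → blaschke c b z = blaschke c b w → f z = f w) :
    ∃ ψ : ℂ → ℂ, IsHInfty ψ ∧ ∀ z ∈ ball (0 : ℂ) 1, f z = ψ (blaschke c b z) := by
  -- `s` is an arbitrary section of the Blaschke product. Only `f ∘ s` matters: openness makes it
  -- continuous, and local inverses make it holomorphic off the critical values.
  have hs : ∀ β : ℂ, ∃ z : ℂ, ‖β‖ < 1 → ‖z‖ < 1 ∧ blaschke c b z = β := by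
    intro β
    by_cases hβ : ‖β‖ < 1
    · obtain ⟨z, hz⟩ := exists_preimage_blaschke hm hc hb hβ
      exact ⟨z, fun _ => hz⟩
    · exact ⟨0, fun h => absurd h hβ⟩
  choose s hs using hs
  have hψ : ∀ z : ℂ, ‖z‖ < 1 → f (s (blaschke c b z)) = f z := fun z hz =>
    have hB := hs _ (norm_blaschke_lt_one hm hc hb hz)
    h _ _ hB.1 hz hB.2
  have hev : ∀ z : ℂ, ‖z‖ < 1 → ∀ᶠ w in 𝓝 z, f (s (blaschke c b w)) = f w := fun z hz =>
    (continuous_norm.continuousAt.eventually_lt_const hz).mono hψ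
  have hcont : ∀ β : ℂ, ‖β‖ < 1 → ContinuousAt (fun β => f (s β)) β := by
    intro β hβ
    obtain ⟨h1, h2⟩ := hs β hβ
    have h3 : Tendsto (fun w => f (s (blaschke c b w))) (𝓝 (s β)) (𝓝 (f (s β))) :=
      ((hf (s β) (by simpa using h1.le)).continuousAt.tendsto).congr'
        ((hev _ h1).mono fun w hw => hw.symm)
    have h4 : Tendsto (fun β => f (s β)) (map (blaschke c b) (𝓝 (s β))) (𝓝 (f (s β))) :=
      tendsto_map'_iff.2 h3
    have h5 := h4.mono_left (nhds_le_map_blaschke hm hc hb h1.le)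
    rwa [h2] at h5
  set K : Set ℂ := blaschke c b '' {z ∈ closedBall (0 : ℂ) 1 | deriv (blaschke c b) z = 0}
  have hK : K.Countable := (countable_critical_blaschke hm hc hb).image _
  have hdiff : ∀ β : ℂ, ‖β‖ < 1 → β ∉ K → DifferentiableAt ℂ (fun β => f (s β)) β := by
    intro β hβ hβK
    obtain ⟨h1, h2⟩ := hs β hβ
    have h1' : s β ∈ closedBall (0 : ℂ) 1 := by simpa using h1.le
    have hd : deriv (blaschke c b) (s β) ≠ 0 := fun h0 => hβK ⟨s β, ⟨h1', h0⟩, h2⟩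
    have hB := (analyticOnNhd_blaschke (c := c) hb _ h1').hasStrictDerivAt
    have hr := hB.to_localInverse hd
    have hr' := HasStrictFDerivAt.eventually_right_inverse
      (hB.hasStrictFDerivAt_equiv hd)
    have hrx : hB.localInverse _ _ _ hd (blaschke c b (s β)) = s β :=
      HasStrictFDerivAt.localInverse_apply_image (hB.hasStrictFDerivAt_equiv hd)
    have hrc := hr.hasDerivAt.continuousAt
    have hcomp : DifferentiableAt ℂ (fun w => f (hB.localInverse _ _ _ hd w))
        (blaschke c b (s β)) := by
      refine DifferentiableAt.comp (g := f) _ ?_ hr.hasDerivAt.differentiableAt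
      rw [hrx]
      exact (hf _ h1').differentiableAt
    have hev' := hrc.eventually (by rw [hrx]; exact hev _ h1)
    rw [h2] at hcomp hev' hr'
    refine hcomp.congr_of_eventuallyEq ?_
    filter_upwards [hev', hr'] with w hw1 hw2
    rw [← hw1]
    exact congrArg (fun x => f (s x)) hw2.symm
  refine ⟨fun β => f (s β), ⟨fun β hβ => ?_, ?_⟩, fun z hz => (hψ z (by simpa using hz)).symm⟩
  -- Continuity together with differentiability off a countable set already gives analyticity.
  · obtain ⟨r, hr, hrs⟩ := nhds_basis_closedBall.mem_iff.1 (isOpen_ball.mem_nhds hβ)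
    have hlt : ∀ z ∈ closedBall β r, ‖z‖ < 1 := fun z hz => by simpa using hrs hz
    have := Complex.hasFPowerSeriesOnBall_of_differentiable_off_countable
      (f := fun β => f (s β)) (R := ⟨r, hr.le⟩) hK (c := β)
      (fun z hz => (hcont z (hlt z hz)).continuousWithinAt)
      (fun z hz => hdiff z (hlt z (ball_subset_closedBall hz.1)) hz.2) hr
    exact this.analyticAt.differentiableAt.differentiableWithinAt
  · obtain ⟨C, hC⟩ := (isCompact_closedBall (0 : ℂ) 1).exists_bound_of_continuousOn
      hf.continuousOn
    exact ⟨C, fun β hβ => hC _ (by simpa using (hs β (by simpa using hβ)).1.le)⟩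

/-- The order of a Blaschke product through which `f` factors is at most the number of zeros
of `f - f(a)` in the disk. -/
theorem le_of_factorization {f B ψ : ℂ → ℂ} (hB : IsBlaschkeOfOrder B m) (hψ : IsHInfty ψ)
    (hf : ∀ z ∈ ball (0 : ℂ) 1, f z = ψ (B z)) {a : ℂ} (ha : ‖a‖ < 1) {n : ℕ} {x : Fin n → ℂ}
    {g : ℂ → ℂ} (hg : AnalyticOnNhd ℂ g (closedBall 0 1))
    (hg0 : ∀ z ∈ closedBall (0 : ℂ) 1, g z ≠ 0)
    (hfac : ∀ z ∈ closedBall (0 : ℂ) 1, f z - f a = (∏ i, (z - x i)) * g z) : m ≤ n := by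
  rcases Nat.eq_zero_or_pos m with rfl | hm
  · exact Nat.zero_le _
  obtain ⟨c, b, hc, hb, rfl⟩ := hB.exists_eq
  set β := blaschke c b a with hβdef
  have hβ : ‖β‖ < 1 := norm_blaschke_lt_one hm hc hb ha
  set P := blaschkePoly c b β
  set Q : ℂ[X] := ∏ i, (X - C (x i)) with hQ
  have hQ0 : Q ≠ 0 := Finset.prod_ne_zero_iff.2 fun i _ => X_sub_C_ne_zero _
  have hQeval : ∀ z, Q.eval z = ∏ i, (z - x i) := fun z => by simp [hQ, eval_prod]
  have hP : P.roots.card = m := card_roots_blaschkePoly hm hc hb hβ.le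
  have hP0 : P ≠ 0 := by
    rintro h
    rw [h] at hP
    simp at hP
    omega
  have hdif : DifferentiableOn ℂ (dslope ψ β) (ball 0 1) :=
    (Complex.differentiableOn_dslope (isOpen_ball.mem_nhds (by simpa using hβ))).2 hψ.1
  -- Dividing `ψ - ψ β` by its argument minus `β` shows that the zeros of `B - β` are among those of
  -- `f - f a`, with multiplicity.
  have hkey : ∀ z ∈ ball (0 : ℂ) 1, Q.eval z * (g z * ∏ i, (1 - (starRingEnd ℂ) (b i) * z)) =
      P.eval z * dslope ψ β (blaschke c b z) := by
    intro z hz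
    have hz' : ‖z‖ < 1 := by simpa using hz
    have h1 := hfac z (ball_subset_closedBall hz)
    have h2 := sub_smul_dslope ψ β (blaschke c b z)
    rw [eval_blaschkePoly_eq β fun i => one_sub_conj_mul_ne_zero (hb i) hz'.le, ← mul_assoc,
      hQeval, ← h1, hf z hz, hf a (by simpa using ha), ← hβdef, ← h2, smul_eq_mul]
    ring
  have hle : P.roots ≤ Q.roots := by
    rw [Multiset.le_iff_count]
    intro y
    rw [count_roots, count_roots]
    by_contra! hlt
    have hPy : P.eval y = 0 :=
      (rootMultiplicity_pos hP0).1 (lt_of_le_of_lt (Nat.zero_le _) hlt)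
    have hy : ‖y‖ < 1 := norm_lt_one_of_root hc hb hβ hPy
    have hyb : y ∈ ball (0 : ℂ) 1 := by simpa using hy
    obtain ⟨P₁, hP₁⟩ := pow_rootMultiplicity_dvd P y
    obtain ⟨Q₁, hQ₁, hQ₁y⟩ := exists_eq_pow_rootMultiplicity_mul_and_not_dvd Q hQ0 y
    set k := rootMultiplicity y P
    set j := rootMultiplicity y Q
    -- After cancelling `(z - y) ^ j`, the right side tends to zero at `y` and the left side does
    -- not.
    have heq : ∀ᶠ z in 𝓝[≠] y, Q₁.eval z * (g z * ∏ i, (1 - (starRingEnd ℂ) (b i) * z)) =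
        (z - y) ^ (k - j) * P₁.eval z * dslope ψ β (blaschke c b z) := by
      filter_upwards [self_mem_nhdsWithin, nhdsWithin_le_nhds (isOpen_ball.mem_nhds hyb)]
        with z hzy hz
      have h := hkey z hz
      rw [hP₁, hQ₁, eval_mul, eval_mul, eval_pow, eval_pow, eval_sub, eval_X, eval_C,
        ← Nat.sub_add_cancel hlt.le, pow_add] at h
      have h0 : (z - y) ^ j ≠ 0 := pow_ne_zero _ (sub_ne_zero.2 hzy)
      refine mul_left_cancel₀ h0 ?_
      rw [← mul_assoc, h]
      ring
    have hcB : ContinuousAt (blaschke c b) y :=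
      (analyticOnNhd_blaschke hb y (ball_subset_closedBall hyb)).continuousAt
    have hcd : ContinuousAt (dslope ψ β) (blaschke c b y) :=
      (hdif.differentiableAt (isOpen_ball.mem_nhds
        (by simpa using norm_blaschke_lt_one hm hc hb hy))).continuousAt
    have hcL : ContinuousAt
        (fun z => Q₁.eval z * (g z * ∏ i, (1 - (starRingEnd ℂ) (b i) * z))) y :=
      Q₁.continuous.continuousAt.mul
        ((hg y (ball_subset_closedBall hyb)).continuousAt.mul (by fun_prop))
    have hcR : ContinuousAt
        (fun z => (z - y) ^ (k - j) * P₁.eval z * dslope ψ β (blaschke c b z)) y :=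
      (ContinuousAt.mul (by fun_prop) P₁.continuous.continuousAt).mul (hcd.comp hcB)
    have hlim := tendsto_nhds_unique_of_eventuallyEq
      (hcL.tendsto.mono_left nhdsWithin_le_nhds) (hcR.tendsto.mono_left nhdsWithin_le_nhds) heq
    rw [sub_self, zero_pow (by omega), zero_mul, zero_mul] at hlim
    refine mul_ne_zero (fun h => hQ₁y (dvd_iff_isRoot.2 h)) (mul_ne_zero
      (hg0 y (ball_subset_closedBall hyb)) (Finset.prod_ne_zero_iff.2 fun i _ =>
        one_sub_conj_mul_ne_zero (hb i) hy.le)) hlim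
  have hQr : Q.roots.card = n := by
    rw [hQ, roots_prod _ _ hQ0]
    simp
  rw [← hP, ← hQr]
  exact Multiset.card_le_card hle

/-- By uniqueness, the given winding number is the number of zeros of `f - f a` in the disk. -/
theorem le_of_mem_windingNumbers {f : ℂ → ℂ} (hf : AnalyticOnNhd ℂ f (closedBall 0 1)) {k : ℤ}
    (hm : m ∈ blaschkeOrders f) (hk : k ∈ windingNumbers f) : (m : ℤ) ≤ k := by
  obtain ⟨B, ψ, hB, hψ, h⟩ := hm
  obtain ⟨a, ha, ha0, hw⟩ := hk
  obtain ⟨n, x, g, hx, hg, hg0, hfac⟩ := exists_factorization (f := fun z => f z - f a)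
    (fun z hz => (hf z hz).sub analyticAt_const)
    (fun z hz => sub_ne_zero.2 (ha0 ⟨z, mem_sphere_zero_iff_norm.2 hz⟩))
  rw [hw.unique (hasWindingNumber_of_factorization hx hg hg0 hfac)]
  exact_mod_cast le_of_factorization hB hψ h ha hg hg0 hfac

end

/-! ### A level taken at most `m` times, found near the boundary of the image. -/

section

open Filter Topology Set Metric

theorem exists_injOn_nhds {f : ℂ → ℂ} {z : ℂ} (hf : AnalyticAt ℂ f z) (hz : deriv f z ≠ 0) :
    ∃ N ∈ 𝓝 z, InjOn f N := by
  have h := hf.hasStrictDerivAt.hasStrictFDerivAt_equiv hz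
  exact ⟨(h.toOpenPartialHomeomorph f).source,
    (h.toOpenPartialHomeomorph f).open_source.mem_nhds h.mem_toOpenPartialHomeomorph_source,
    (h.toOpenPartialHomeomorph f).injOn⟩

theorem image_mem_nhds_of_deriv_ne_zero {f : ℂ → ℂ} {z : ℂ} (hf : AnalyticAt ℂ f z)
    (hz : deriv f z ≠ 0) {s : Set ℂ} (hs : s ∈ 𝓝 z) : f '' s ∈ 𝓝 (f z) := by
  rw [← hf.hasStrictDerivAt.map_nhds_eq hz]
  exact image_mem_map hs

theorem deriv_eq_zero_of_double {f g : ℂ → ℂ} {e : ℂ} {n : ℕ} {x : Fin n → ℂ}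
    (hx : ∀ i, ‖x i‖ < 1) (hg : AnalyticOnNhd ℂ g (closedBall 0 1))
    (hf : ∀ z ∈ closedBall (0 : ℂ) 1, f z - e = (∏ i, (z - x i)) * g z) {i j : Fin n}
    (hij : i ≠ j) (hxij : x i = x j) : deriv f (x i) = 0 := by
  have hxi : x i ∈ ball (0 : ℂ) 1 := by simpa using hx i
  set G : ℂ → ℂ := fun z => (∏ k ∈ (Finset.univ.erase i).erase j, (z - x k)) * g z
  have hG : DifferentiableAt ℂ G (x i) := by
    have := (hg _ (ball_subset_closedBall hxi)).differentiableAt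
    fun_prop
  have heq : f =ᶠ[𝓝 (x i)] fun z => (z - x i) * ((z - x i) * G z) + e := by
    filter_upwards [isOpen_ball.mem_nhds hxi] with z hz
    have h := hf z (ball_subset_closedBall hz)
    rw [← Finset.mul_prod_erase _ _ (Finset.mem_univ i),
      ← Finset.mul_prod_erase _ _ (Finset.mem_erase.2 ⟨hij.symm, Finset.mem_univ j⟩), ← hxij] at h
    linear_combination h
  have h1 : HasDerivAt (fun z => z - x i) 1 (x i) := (hasDerivAt_id _).sub_const _
  rw [heq.deriv_eq, ((h1.fun_mul (h1.fun_mul hG.hasDerivAt)).add_const e).deriv]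
  simp

variable {φ : ℂ → ℂ}

/-- The image of the closed disk has uncountable boundary. -/
theorem IsSymbol.not_countable_frontier (hφ : IsSymbol φ) :
    ¬ (frontier (φ '' closedBall 0 1)).Countable := by
  intro hcount
  have hK : IsCompact (φ '' closedBall (0 : ℂ) 1) :=
    (isCompact_closedBall 0 1).image_of_continuousOn hφ.holomorphic.continuousOn
  have hconn := isPreconnected_compl_of_countable hcount
  obtain ⟨z, hz, hz1⟩ := (dense_compl_of_countable hφ.countable_critical).inter_open_nonempty
    (ball 0 1) isOpen_ball ⟨0, by simp⟩
  have hint : φ z ∈ interior (φ '' closedBall 0 1) := mem_interior_iff_mem_nhds.2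
    (image_mem_nhds_of_deriv_ne_zero (hφ.holomorphic z (ball_subset_closedBall hz)) hz1
      (mem_of_superset (isOpen_ball.mem_nhds hz) ball_subset_closedBall))
  obtain ⟨q, hq⟩ := (ne_univ_iff_exists_notMem _).1 hK.ne_univ
  have hfr := hK.isClosed.frontier_eq
  -- The complement of a countable frontier would be connected, yet it splits into the interior and
  -- the exterior, both nonempty.
  obtain ⟨x, -, hx1, hx2⟩ := hconn _ _ isOpen_interior hK.isClosed.isOpen_compl
    (fun y hy => by
      by_cases h : y ∈ φ '' closedBall 0 1
      · left
        by_contra h'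
        exact hy (hfr ▸ ⟨h, h'⟩)
      · exact Or.inr h)
    ⟨φ z, fun h => (hfr ▸ h).2 hint, hint⟩ ⟨q, fun h => hq (hfr ▸ h).1, hq⟩
  exact hx2 (interior_subset hx1)

variable {m : ℕ} {c : ℂ} {b : Fin m → ℂ}

/-- If the fibers of `φ` over all but countably many points of the circle are fibers of a Blaschke
product of order `m`, then some level `φ(a)` is taken at most `m` times in the closed disk. -/
theorem IsSymbol.exists_factorization_le (hφ : IsSymbol φ) (hm : 0 < m) (hc : ‖c‖ = 1)
    (hb : ∀ i, ‖b i‖ < 1)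
    (h1 : ∀ z w, ‖z‖ ≤ 1 → ‖w‖ ≤ 1 → blaschke c b z = blaschke c b w → φ z = φ w) {A : Set ℂ}
    (hA : A.Countable)
    (h2 : ∀ z w, ‖z‖ = 1 → ‖w‖ = 1 → z ∉ A → φ w = φ z → blaschke c b w = blaschke c b z) :
    ∃ (a : ℂ) (n : ℕ) (x : Fin n → ℂ) (g : ℂ → ℂ), ‖a‖ < 1 ∧ n ≤ m ∧
      (∀ w : Circle, φ w ≠ φ a) ∧ (∀ i, ‖x i‖ < 1) ∧ AnalyticOnNhd ℂ g (closedBall 0 1) ∧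
      (∀ z ∈ closedBall (0 : ℂ) 1, g z ≠ 0) ∧
      ∀ z ∈ closedBall (0 : ℂ) 1, φ z - φ a = (∏ i, (z - x i)) * g z := by
  -- Choose a frontier value attained neither on `A` nor at a critical point.
  obtain ⟨p, hpf, hpA⟩ := not_subset.1 fun hsub => hφ.not_countable_frontier
    (((hA.union hφ.countable_critical).image φ).mono hsub)
  have hK : IsCompact (φ '' closedBall (0 : ℂ) 1) :=
    (isCompact_closedBall 0 1).image_of_continuousOn hφ.holomorphic.continuousOn
  rw [hK.isClosed.frontier_eq] at hpf
  obtain ⟨⟨η, hη, hηp⟩, hpi⟩ := hpf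
  have hcrit : ∀ z, φ z = p → z ∉ A ∧ deriv φ z ≠ 0 := fun z hz =>
    ⟨fun h => hpA ⟨z, Or.inl h, hz⟩, fun h => hpA ⟨z, Or.inr h, hz⟩⟩
  -- A noncritical preimage inside the disk would make `p` an interior point.
  have hnorm : ∀ z ∈ closedBall (0 : ℂ) 1, φ z = p → ‖z‖ = 1 := by
    intro z hz hzp
    by_contra h
    have hlt : z ∈ ball (0 : ℂ) 1 := by
      simpa using lt_of_le_of_ne (by simpa using hz) h
    refine hpi (mem_interior_iff_mem_nhds.2 (hzp ▸ ?_))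
    exact image_mem_nhds_of_deriv_ne_zero (hφ.holomorphic z hz) (hcrit z hzp).2
      (mem_of_superset (isOpen_ball.mem_nhds hlt) ball_subset_closedBall)
  have hη1 := hnorm η hη hηp
  have hBη : ContinuousAt (blaschke c b) η := (analyticOnNhd_blaschke hb η hη).continuousAt
  have hφη : ContinuousAt φ η := (hφ.holomorphic η hη).continuousAt
  have hloc : ∀ w ∈ closedBall (0 : ℂ) 1, ∀ᶠ q : ℂ × ℂ in 𝓝 (η, w), ‖q.1‖ < 1 → ‖q.2‖ ≤ 1 →
      φ q.2 = φ q.1 → blaschke c b q.2 = blaschke c b q.1 ∧ deriv φ q.2 ≠ 0 := by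
    intro w hw
    have hφw : ContinuousAt φ w := (hφ.holomorphic w hw).continuousAt
    by_cases hwp : φ w = p
    · have hw1 := hnorm w hw hwp
      have hBw : blaschke c b w = blaschke c b η :=
        h2 η w hη1 hw1 (hcrit η hηp).1 (hwp.trans hηp.symm)
      -- Openness at `w` produces a point `u` of `N` on the same level of the Blaschke product as
      -- `a`. Then `φ u = φ a = φ v`, and injectivity on `N` forces `u = v`.
      obtain ⟨N, hN, hinj⟩ := exists_injOn_nhds (hφ.holomorphic w hw) (hcrit w hwp).2
      have himg : blaschke c b '' {v | v ∈ N ∧ ∀ i, 1 - (starRingEnd ℂ) (b i) * v ≠ 0} ∈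
          𝓝 (blaschke c b η) := by
        rw [← hBw]
        exact nhds_le_map_blaschke hm hc hb hw1.le
          (image_mem_map (inter_mem hN (eventually_den_ne_zero hb hw1.le)))
      have hd : ∀ᶠ v in 𝓝 w, deriv φ v ≠ 0 :=
        (hφ.holomorphic w hw).deriv.continuousAt.eventually_ne (hcrit w hwp).2
      filter_upwards [(hBη.eventually himg).prod_nhds (hd.and hN)] with ⟨a, v⟩ ⟨h3, h4⟩ ha hv hva
      refine ⟨?_, h4.1⟩
      obtain ⟨u, ⟨huN, hud⟩, hu⟩ := h3
      have hu1 : ‖u‖ < 1 := by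
        by_contra! h
        have h5 := one_le_norm_blaschke hc hb h hud
        rw [hu] at h5
        exact absurd (norm_blaschke_lt_one hm hc hb ha) (not_lt.2 h5)
      have h6 := hinj huN h4.2 ((h1 u a hu1.le ha.le hu).trans hva.symm)
      exact h6 ▸ hu
    · have h3 : ContinuousAt (fun q : ℂ × ℂ => φ q.2 - φ q.1) (η, w) :=
        (ContinuousAt.comp (f := Prod.snd) hφw continuousAt_snd).sub
          (ContinuousAt.comp (f := Prod.fst) hφη continuousAt_fst)
      filter_upwards [h3.eventually_ne (sub_ne_zero.2 (by rwa [hηp]))] with q hq _ _ h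
      exact absurd h (sub_ne_zero.1 hq)
  have hev := (isCompact_closedBall (0 : ℂ) 1).eventually_forall_of_forall_eventually
    (P := fun a w => ‖a‖ < 1 → ‖w‖ ≤ 1 → φ w = φ a → blaschke c b w = blaschke c b a ∧
      deriv φ w ≠ 0) hloc
  have hcl : η ∈ closure (ball (0 : ℂ) 1) := by rwa [closure_ball _ one_ne_zero]
  obtain ⟨a, haD, ha⟩ := ((mem_closure_iff_frequently.1 hcl).and_eventually hev).exists
  have ha1 : ‖a‖ < 1 := by simpa using haD
  replace ha : ∀ w, ‖w‖ ≤ 1 → φ w = φ a → blaschke c b w = blaschke c b a ∧ deriv φ w ≠ 0 :=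
    fun w hw => ha w (by simpa using hw) ha1 hw
  -- All solutions of `φ w = φ a` share the level of `a`, whose value lies inside the disk, so none
  -- is on the circle.
  have hT : ∀ z : ℂ, ‖z‖ = 1 → φ z ≠ φ a := fun z hz h => by
    have h3 := norm_blaschke_eq_one hc hb hz
    rw [(ha z hz.le h).1] at h3
    exact (norm_blaschke_lt_one hm hc hb ha1).ne h3
  obtain ⟨n, x, g, hx, hg, hg0, hfac⟩ := exists_factorization (f := fun z => φ z - φ a)
    (fun z hz => (hφ.holomorphic z hz).sub analyticAt_const)
    (fun z hz => sub_ne_zero.2 (hT z hz))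
  refine ⟨a, n, x, g, ha1, ?_, fun w => hT w w.norm_coe, hx, hg, hg0, hfac⟩
  have hxa : ∀ i, φ (x i) = φ a := fun i => by
    have := hfac (x i) (by simpa using (hx i).le)
    rw [Finset.prod_eq_zero (Finset.mem_univ i) (sub_self _), zero_mul] at this
    exact sub_eq_zero.1 this
  have hinj : Function.Injective x := fun i j hij => by
    by_contra hne
    exact (ha (x i) (hx i).le (hxa i)).2 (deriv_eq_zero_of_double hx hg hfac hne hij)
  obtain ⟨hfin, hle⟩ := ncard_blaschke_le hm hc hb (norm_blaschke_lt_one hm hc hb ha1).le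
  calc n = (range x).ncard := by
        rw [← image_univ, ncard_image_of_injective _ hinj, ncard_univ, Nat.card_fin]
    _ ≤ _ := ncard_le_ncard (by
        rintro _ ⟨i, rfl⟩
        exact ⟨by simpa using (hx i).le, (ha (x i) (hx i).le (hxa i)).1⟩) hfin
    _ ≤ m := hle

end

/-! ### Symmetries of a Blaschke product on the circle. -/

section

open Filter Topology Set Metric

variable {m : ℕ} {c : ℂ} {b : Fin m → ℂ}

/-- Local injectivity of the Blaschke product on the circle makes the coincidence set of two
symmetries clopen. -/
theorem injOn_eval_one (hm : 0 < m) (hc : ‖c‖ = 1) (hb : ∀ i, ‖b i‖ < 1) :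
    InjOn (fun ρ : C(Circle, Circle) => ρ 1)
      {ρ | ∀ w : Circle, blaschke c b (ρ w) = blaschke c b w} := by
  intro ρ hρ σ hσ h1
  have hclopen : IsClopen {w | ρ w = σ w} := by
    refine ⟨isClosed_eq ρ.continuous σ.continuous, isOpen_iff_mem_nhds.2 fun w hw => ?_⟩
    have hx : ‖(ρ w : ℂ)‖ = 1 := Circle.norm_coe _
    obtain ⟨N, hN, hinj⟩ := exists_injOn_nhds
      (analyticOnNhd_blaschke (c := c) hb (ρ w : ℂ) (by simpa using hx.le))
      (deriv_blaschke_ne_zero hm hc hb hx)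
    have h2 : ∀ᶠ v in 𝓝 w, (ρ v : ℂ) ∈ N :=
      (continuous_subtype_val.comp ρ.continuous).continuousAt.eventually hN
    have h3 : ∀ᶠ v in 𝓝 w, (σ v : ℂ) ∈ N := by
      have hN' : N ∈ 𝓝 (σ w : ℂ) := by rwa [← show ρ w = σ w from hw]
      exact (continuous_subtype_val.comp σ.continuous).continuousAt.eventually hN'
    filter_upwards [h2, h3] with v hv1 hv2
    exact Circle.ext (hinj hv1 hv2 ((hρ v).trans (hσ v).symm))
  have := hclopen.eq_univ ⟨1, h1⟩
  exact ContinuousMap.ext fun w => this.ge (mem_univ w)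

/-- In the coordinate given by the increasing argument `θ`, a symmetry is a translation. -/
theorem exists_symmetry (hm : 0 < m) (hc : ‖c‖ = 1) (hb : ∀ i, ‖b i‖ < 1) {w₀ : Circle}
    (hw₀ : blaschke c b w₀ = blaschke c b 1) :
    ∃ ρ : C(Circle, Circle), (∀ w : Circle, blaschke c b (ρ w) = blaschke c b w) ∧ ρ 1 = w₀ := by
  obtain ⟨θ, κ, hθ, hκ, hper, harg⟩ := exists_argument (c := c) hm hb
  have hB1 : blaschke c b 1 ≠ 0 := by
    rw [← norm_ne_zero_iff, norm_blaschke_eq_one hc hb (by simp)]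
    exact one_ne_zero
  have hmono : StrictMono θ := strictMono_of_hasDerivAt_pos hθ hκ
  have hcont : Continuous θ := continuous_iff_continuousAt.2 fun t => (hθ t).continuousAt
  have hpi : 0 < 2 * Real.pi := Real.two_pi_pos
  set C := θ (2 * Real.pi) - θ 0 with hC
  have hCpos : 0 < C := sub_pos.2 (hmono hpi)
  have hshift : ∀ t, θ (t + 2 * Real.pi) = θ t + C := by
    have hd : ∀ t, HasDerivAt (fun t => θ (t + 2 * Real.pi) - θ t) 0 t := fun t =>
      ((hθ (t + 2 * Real.pi)).comp_add_const t (2 * Real.pi) |>.fun_sub (hθ t)).congr_deriv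
        (by rw [hper, sub_self])
    intro t
    have := is_const_of_deriv_eq_zero (fun t => (hd t).differentiableAt)
      (fun t => (hd t).deriv) t 0
    simp only [zero_add] at this
    linarith
  -- Subtracting the linear part determines `θ` at multiples of `2π`. These values are unbounded on
  -- both sides, which makes `θ` surjective.
  have hP : Function.Periodic (fun t => θ t - C / (2 * Real.pi) * t) (2 * Real.pi) := by
    intro t
    simp only [hshift]
    field_simp
    ring
  have hint : ∀ n : ℤ, θ (n * (2 * Real.pi)) = θ 0 + n * C := by
    intro n
    have h := hP.int_mul_eq n
    simp only [mul_zero, sub_zero] at h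
    have h2 : C / (2 * Real.pi) * (n * (2 * Real.pi)) = n * C := by field_simp
    linarith
  have hsurj : Function.Surjective θ := by
    intro y
    obtain ⟨n, hn⟩ := exists_int_gt ((y - θ 0) / C)
    obtain ⟨k, hk⟩ := exists_int_lt ((y - θ 0) / C)
    rw [div_lt_iff₀ hCpos] at hn
    rw [lt_div_iff₀ hCpos] at hk
    exact mem_range_of_exists_le_of_exists_ge hcont ⟨k * (2 * Real.pi), by rw [hint]; linarith⟩
      ⟨n * (2 * Real.pi), by rw [hint]; linarith⟩
  set e := hmono.orderIsoOfSurjective θ hsurj with he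
  have heθ : ∀ t, e t = θ t := fun t => rfl
  obtain ⟨t₀, rfl⟩ := Circle.exp_surjective w₀
  -- The translation carries `θ 0` to `θ t₀`. It commutes with the shift by `2π` and so descends to
  -- the circle.
  set τ : ℝ → ℝ := fun t => e.symm (θ t + (θ t₀ - θ 0)) with hτ
  have hθτ : ∀ t, θ (τ t) = θ t + (θ t₀ - θ 0) := fun t => by
    rw [← heθ (τ t), hτ, e.apply_symm_apply]
  have hτc : Continuous τ := e.symm.continuous.comp (hcont.add continuous_const)
  have hτp : Function.Periodic (fun t => τ t - t) (2 * Real.pi) := by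
    intro t
    have : τ (t + 2 * Real.pi) = τ t + 2 * Real.pi := hmono.injective (by
      rw [hθτ, hshift, hshift, hθτ]; ring)
    simp only [this]
    ring
  have hfac : Function.FactorsThrough (fun t => Circle.exp (τ t)) Circle.exp := by
    intro s t hst
    obtain ⟨n, rfl⟩ := Circle.exp_eq_exp.1 hst
    have h := hτp.int_mul n t
    exact Circle.exp_eq_exp.2 ⟨n, by linarith⟩
  have hq : IsQuotientMap Circle.exp :=
    isLocalHomeomorph_circleExp.isOpenMap.isQuotientMap Circle.exp.continuous
      Circle.exp_surjective
  obtain ⟨ρ, hρ⟩ : ∃ ρ : C(Circle, Circle), ∀ t, ρ (Circle.exp t) = Circle.exp (τ t) :=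
    ⟨hq.lift ⟨_, Circle.exp.continuous.comp hτc⟩ hfac, fun t =>
      DFunLike.congr_fun (hq.lift_comp ⟨_, Circle.exp.continuous.comp hτc⟩ hfac) t⟩
  have hexp : ∀ t, blaschke c b (Circle.exp t) = blaschke c b 1 →
      Complex.exp (Complex.I * θ t) = 1 := fun t ht => by
    rw [harg] at ht
    exact mul_left_cancel₀ hB1 (ht.trans (mul_one _).symm)
  refine ⟨ρ, fun w => ?_, ?_⟩
  · obtain ⟨t, rfl⟩ := Circle.exp_surjective w
    rw [hρ, harg, harg, hθτ]
    push_cast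
    rw [mul_add, mul_sub, Complex.exp_add, Complex.exp_sub, hexp t₀ hw₀, hexp 0 (by simp)]
    simp
  · rw [← Circle.exp_zero, hρ]
    congr 1
    exact hmono.injective (by rw [hθτ]; ring)

theorem encard_symmetries_blaschke (hm : 0 < m) (hc : ‖c‖ = 1) (hb : ∀ i, ‖b i‖ < 1) :
    {ρ : C(Circle, Circle) | ∀ w : Circle, blaschke c b (ρ w) = blaschke c b w}.encard = m := by
  rw [← encard_blaschke_circle hm hc hb (norm_blaschke_eq_one hc hb (norm_one (α := ℂ))),
    ← (injOn_eval_one hm hc hb).encard_image]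
  congr 1
  ext w
  constructor
  · rintro ⟨ρ, hρ, rfl⟩
    simpa using hρ 1
  · intro hw
    obtain ⟨ρ, hρ, hρ1⟩ := exists_symmetry hm hc hb hw
    exact ⟨ρ, hρ, hρ1⟩

end

/-! ### Normalization of the symbol and the coincidence of the four numbers. -/

section

open Filter Topology Set Metric

/-- Passing to the meromorphic normal form removes arbitrary values at removable points and leaves
`φ` unchanged on the closed disk. -/
theorem MeroClosedDisk.exists_isSymbol {φ : ℂ → ℂ} (hφ : MeroClosedDisk φ)
    (hnc : ¬ ∃ c : ℂ, ∀ z ∈ closedBall (0 : ℂ) 1, φ z = c) :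
    ∃ f : ℂ → ℂ, IsSymbol f ∧ EqOn f φ (closedBall 0 1) := by
  have hm : MeromorphicOn φ univ := meromorphicOn_univ.2 hφ.meromorphic
  set f := toMeromorphicNFOn φ univ with hf
  have hnf : ∀ z, MeromorphicNFAt f z := fun z => meromorphicNFOn_toMeromorphicNFOn φ univ (mem_univ z)
  have hnear : ∀ z ∈ closedBall (0 : ℂ) 1, f =ᶠ[𝓝 z] φ := by
    intro z hz
    have h := toMeromorphicNFOn_eq_toMeromorphicNFAt_on_nhds hm (mem_univ z)
    rwa [toMeromorphicNFAt_eq_self.2 (hφ.holomorphic z hz).meromorphicNFAt] at h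
  have heq : EqOn f φ (closedBall 0 1) := fun z hz => (hnear z hz).eq_of_nhds
  refine ⟨f, ⟨fun z hz => (hφ.holomorphic z hz).congr (hnear z hz).symm, fun z => ?_, ?_, ?_⟩, heq⟩
  · rw [← (hnf z).meromorphicOrderAt_nonneg_iff_analyticAt,
      tendsto_cobounded_iff_meromorphicOrderAt_neg (hnf z).meromorphicAt]
    exact le_or_gt _ _
  · exact Meromorphic.countable_compl_analyticAt fun z => (hnf z).meromorphicAt
  · rintro ⟨c, hc⟩
    exact hnc ⟨c, fun z hz => (heq hz).symm.trans (hc z hz)⟩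

theorem windingNumbers_congr {f φ : ℂ → ℂ} (h : EqOn f φ (closedBall 0 1)) :
    windingNumbers f = windingNumbers φ := by
  have hT : ∀ w : Circle, f w = φ w := fun w => h (by simpa using (Circle.norm_coe w).le)
  ext k
  refine exists_congr fun a => and_congr_right fun ha => ?_
  rw [h (by simpa using ha.le)]
  simp only [hT]

theorem blaschkeOrders_congr {f φ : ℂ → ℂ} (h : EqOn f φ (closedBall 0 1)) :
    blaschkeOrders f = blaschkeOrders φ := by
  ext m
  refine exists_congr fun B => exists_congr fun ψ => and_congr_right fun _ =>
    and_congr_right fun _ => forall₂_congr fun z hz => ?_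
  rw [h (ball_subset_closedBall hz)]

theorem symmetries_congr {f φ : ℂ → ℂ} (h : EqOn f φ (closedBall 0 1)) :
    symmetries f = symmetries φ := by
  have hT : ∀ w : Circle, f w = φ w := fun w => h (by simpa using (Circle.norm_coe w).le)
  simp only [symmetries, hT]

theorem selfIntersection_congr {f φ : ℂ → ℂ} (h : EqOn f φ (closedBall 0 1)) :
    selfIntersection f = selfIntersection φ := by
  have hT : ∀ w : Circle, f w = φ w := fun w => h (by simpa using (Circle.norm_coe w).le)
  funext η
  simp only [selfIntersection, hT]

theorem IsSymbol.coincidence {φ : ℂ → ℂ} (hφ : IsSymbol φ) :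
    ∃ n : ℕ, IsLeast (windingNumbers φ) (n : ℤ) ∧ IsGreatest (blaschkeOrders φ) n ∧
      (symmetries φ).encard = (n : ℕ∞) ∧ IsLeast (range (selfIntersection φ)) (n : ℕ∞) := by
  obtain ⟨m, c, b, hm, hc, hb, h1, A, hA, h2⟩ := hφ.exists_blaschke
  have hmem : m ∈ blaschkeOrders φ := by
    obtain ⟨ψ, hψ, h⟩ := exists_comp_blaschke hm hc hb hφ.holomorphic
      fun z w hz hw => h1 z w hz.le hw.le
    exact ⟨_, ψ, isBlaschkeOfOrder_blaschke hc hb, hψ, h⟩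
  obtain ⟨a, n, x, g, ha, hnm, haT, hx, hg, hg0, hfac⟩ :=
    hφ.exists_factorization_le hm hc hb h1 hA h2
  have hub : ∀ k ∈ blaschkeOrders φ, k ≤ n := by
    rintro k ⟨B, ψ, hB, hψ, h⟩
    exact le_of_factorization hB hψ h ha hg hg0 hfac
  -- The zero count `n` at the special level is at most `m`, and at least `m` because `φ` factors
  -- through the Blaschke product.
  obtain rfl : n = m := le_antisymm hnm (hub m hmem)
  have hcoe : ∀ w : Circle, ‖(w : ℂ)‖ = 1 := Circle.norm_coe
  have hsub : ∀ η : Circle, {w : Circle | blaschke c b w = blaschke c b η} ⊆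
      {w : Circle | φ w = φ η} := fun η w hw => h1 w η (hcoe w).le (hcoe η).le hw
  have hcard : ∀ η : Circle, {w : Circle | blaschke c b w = blaschke c b η}.encard = n :=
    fun η => encard_blaschke_circle hm hc hb (norm_blaschke_eq_one hc hb (hcoe η))
  have hdense := dense_circle_of_countable hA
  refine ⟨n, ⟨⟨a, ha, haT, hasWindingNumber_of_factorization hx hg hg0 hfac⟩, fun k hk =>
    le_of_mem_windingNumbers hφ.holomorphic hmem hk⟩, ⟨hmem, hub⟩, ?_, ?_, ?_⟩
  -- A symmetry of `φ` preserves the Blaschke product off `A`, hence everywhere by continuity and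
  -- density.
  · rw [← encard_symmetries_blaschke hm hc hb]
    congr 1
    ext ρ
    refine ⟨fun hρ => ?_, fun hρ w => h1 _ _ (hcoe _).le (hcoe _).le (hρ w)⟩
    have hB : Continuous fun w : Circle => blaschke c b w :=
      (analyticOnNhd_blaschke hb).continuousOn.comp_continuous continuous_subtype_val
        fun w => by simpa using (hcoe w).le
    exact fun w => congrFun (Continuous.ext_on hdense (hB.comp ρ.continuous) hB
      fun w hw => h2 w (ρ w) (hcoe w) (hcoe _) hw (hρ w)) w
  -- Off `A` the levels of `φ` and of the Blaschke product agree, so the minimum is attained there.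
  · obtain ⟨η, hη⟩ := hdense.nonempty
    refine ⟨η, ?_⟩
    rw [selfIntersection, ← hcard η]
    congr 1
    exact Subset.antisymm (fun w hw => h2 η w (hcoe η) (hcoe w) hη hw) (hsub η)
  · rintro _ ⟨η, rfl⟩
    rw [selfIntersection, ← hcard η]
    exact encard_le_encard (hsub η)

end

end SymbolCurve

theorem theorem1p5 (φ : ℂ → ℂ) (hφ : SymbolCurve.MeroClosedDisk φ)
    (hnc : ¬ ∃ c : ℂ, ∀ z ∈ Metric.closedBall (0 : ℂ) 1, φ z = c) :
    ∃ n : ℕ,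
      IsLeast (SymbolCurve.windingNumbers φ) (n : ℤ) ∧
      IsGreatest (SymbolCurve.blaschkeOrders φ) n ∧
      (SymbolCurve.symmetries φ).encard = (n : ℕ∞) ∧
      IsLeast (Set.range (SymbolCurve.selfIntersection φ)) (n : ℕ∞) := by
  obtain ⟨f, hf, h⟩ := hφ.exists_isSymbol hnc
  rw [← SymbolCurve.windingNumbers_congr h, ← SymbolCurve.blaschkeOrders_congr h,
    ← SymbolCurve.symmetries_congr h, ← SymbolCurve.selfIntersection_congr h]
  exact hf.coincidence
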